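/- Let $d,K\in\mathbb N$, $H\in(\tfrac13,1)$ and $T>0$. For $x:[0,T]\to E$ (a Euclidean space) write $\delta x_{st}=x_t-x_s$, and for a map $A$ on $\{0\le s\le t\le T\}$ let $[A]_\alpha=\sup_{s\le t}|A_{st}|/|t-s|^\alpha$ (with $0/0=0$); $A\in C_2^\alpha$ means $[A]_\alpha<\infty$, $x\in C^\alpha$ means $\delta x\in C_2^\alpha$, and $[x]_\alpha=[\delta x]_\alpha$, $\|x\|_\alpha=\|x\|_\infty+[x]_\alpha$. For a vector field $\sigma$ and a differentiable map $g$ put $\sigma[g](x)=\sum_j\sigma^j(x)\,\partial_{x_j}g(x)$. **Noise and equation.** Let $B=(B^1,\dots,B^K)$ be an $\mathbb R^K$-valued fractional Brownian motion with Hurst index $H$, that is, a centred Gaussian process on $[0,\infty)$ with almost surely continuous paths and $\mathbb E[B_s\otimes B_t]=\frac12(s^{2H}+t^{2H}-|t-s|^{2H})I$. If $H\le\frac12$, let $\mathbb B$ be a rough path lift of $B$: almost surely, for all $\beta\in(\frac13,H)$, $B\in C^\beta$, $\mathbb B\in C_2^{2\beta}$ and $\mathbb B_{st}=\mathbb B_{sr}+\delta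 B_{sr}\otimes\delta B_{rt}+\mathbb B_{rt}$ for $s\le r\le t$. Let $\alpha\in(\frac13,H)$, with $\alpha>\frac12$ if $H>\frac12$. Let $u:[0,T]\times\mathbb R^d\to\mathbb R^d$ be continuous and $\sigma_1,\dots,\sigma_K\in C^{\lfloor1/\alpha\rfloor}(\mathbb R^d;\mathbb R^d)$ (for a parametrised family, $\sigma_k=\sigma_k(\cdot\,;\theta)$ with $\theta$ fixed). Let $y:\Omega\times[0,T]\to\mathbb R^d$ be a pathwise solution of $$dy_t=u_t(y_t)\,dt+\sum_{k=1}^K\sigma_k(y_t)\,d\mathbf B^k_t,$$ that is, almost surely $y\in C^\alpha$, $$y^\sharp_{st}:=\delta y_{st}-\int_s^tu_r(y_r)\,dr-\sum_k\sigma_k(y_s)\,\delta B^k_{st}\in C_2^{2\alpha},$$ and, if $\alpha\le\frac12$, also $y^\sharp_{st}-\sum_{k,l}\sigma_l[\sigma_k](y_s)\,\mathbb B^{l,k}_{st}\in C_2^{3\alpha}$. **Estimator.** Let $t_i=iT2^{-n}$, $0\le i\le 2^n$. For $x:[0,T]\to\mathbb R$ and $\gamma\in\mathbb R$ let $$\langle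 x\rangle^{(\gamma),n}_t=\sum_{i:\,t_{i+1}\le t}(t_{i+1}-t_i)^\gamma(\delta x_{t_it_{i+1}})^2,$$ let $\langle\langle y\rangle\rangle^{(\gamma),n}_t=\sum_{i=1}^d\langle y^i\rangle^{(\gamma),n}_t$, and $$H_n=\frac12\Big(1-\frac{\ln S_n}{\ln2}\Big),\qquad S_n=\frac{\langle\langle y\rangle\rangle^{(0),n+1}_T}{\langle\langle y\rangle\rangle^{(0),n}_T}.$$ Let $\delta_n=2^{-n/2}\sqrt n$ if $H\le\frac12$ and $\delta_n=2^{-n(1-H)}\sqrt n$ if $H>\frac12$. **Claim.** For all $f\in C^2(\mathbb R^d)$ and $\varepsilon>0$, for almost every $\omega$ with $\sum_k\int_0^T|\sigma_k(y_r)|^2\,dr>0$, $$\langle f(y)\rangle^{(1-2H_n),n}_t-\sum_{k=1}^K\int_0^t|\sigma_k[f](y_r)|^2\,dr=O_C\big(n\,\delta_n^{H-\varepsilon}\big)\qquad(n\to\infty)$$ uniformly in $t\in[0,T]$. That is, there is $n_0(\omega)$ such that for all $n\ge n_0(\omega)$ and all $t\in[0,T]$ the absolute value of the left-hand side is at most $C\,n\,\delta_n^{H-\varepsilon}$.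 Here $C=C\big(T,\|B\|_{H-\varepsilon},\|f(y)'\|_{H-\varepsilon},[f(y)^\sharp]_{2(H-\varepsilon)}\big)$ for a deterministic finite function $C$ of these quantities (values in $[0,\infty]$) that is determined by $d,K,H,\varepsilon$ alone, with $f(y)'=(\sigma_k[f](y))_{k}$ and $f(y)^\sharp_{st}=\delta f(y)_{st}-\sum_k\sigma_k[f](y_s)\,\delta B^k_{st}$. -/

import Mathlib

open MeasureTheory ProbabilityTheory Filter Set
open scoped ENNReal NNReal

noncomputable section

/-- The Hölder seminorm `[A]_α = sup_{0 ≤ s ≤ t ≤ T} |A s t| / |t - s| ^ α`, in `[0, ∞]`, of a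
two-parameter map on the simplex `{(s, t) : 0 ≤ s ≤ t ≤ T}`, with the conventions `0 / 0 = 0` and
`c / 0 = ∞` for `c > 0`. -/
def holderSeminorm₂ {E : Type*} [NormedAddCommGroup E] (T α : ℝ) (A : ℝ → ℝ → E) : ℝ≥0∞ :=
  ⨆ s ∈ Icc (0 : ℝ) T, ⨆ t ∈ Icc s T, ‖A s t‖ₑ / ENNReal.ofReal ((t - s) ^ α)

/-- The Hölder seminorm on `[0, T]` of a path. -/
def holderSeminorm {E : Type*} [NormedAddCommGroup E] (T α : ℝ) (x : ℝ → E) : ℝ≥0∞ :=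
  holderSeminorm₂ T α (fun s t => x t - x s)

/-- The Hölder norm `‖x‖_α = ‖x‖_∞ + [x]_α` on `[0, T]` of a path. -/
def holderNorm {E : Type*} [NormedAddCommGroup E] (T α : ℝ) (x : ℝ → E) : ℝ≥0∞ :=
  (⨆ t ∈ Icc (0 : ℝ) T, ‖x t‖ₑ) + holderSeminorm T α x

/-- `x ∈ C^α([0, T]; E)`. -/
def IsHolderPath {E : Type*} [NormedAddCommGroup E] (T α : ℝ) (x : ℝ → E) : Prop :=
  holderSeminorm T α x < ∞

/-- `A ∈ C_2^α([0, T]; E)`. -/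
def IsTwoParamHolder {E : Type*} [NormedAddCommGroup E] (T α : ℝ) (A : ℝ → ℝ → E) : Prop :=
  holderSeminorm₂ T α A < ∞

/-- `(z, Z)` is an `α`-Hölder rough path over `[0, T]` (used for `1/3 < α ≤ 1/2`):
`z ∈ C^α`, `Z ∈ C_2^{2α}`, and Chen's relation holds. -/
structure IsHolderRoughPath {K : ℕ} (T α : ℝ) (z : ℝ → EuclideanSpace ℝ (Fin K))
    (Z : ℝ → ℝ → Fin K → Fin K → ℝ) : Prop where
  holder_path : IsHolderPath T α z
  holder_area : IsTwoParamHolder T (2 * α) Z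
  chen : ∀ s r t : ℝ, 0 ≤ s → s ≤ r → r ≤ t → t ≤ T → ∀ i j : Fin K,
    Z s t i j = Z s r i j + (z r i - z s i) * (z t j - z r j) + Z r t i j

/-- The derivative `σ[f]` of a map `f` along a vector field `σ`:
`σ[f](x) = ∑ j, σ^j(x) ∂_j f(x)`. -/
def lieAction {E F : Type*} [NormedAddCommGroup E] [NormedSpace ℝ E]
    [NormedAddCommGroup F] [NormedSpace ℝ F] (σ : E → E) (f : E → F) (x : E) : F :=
  fderiv ℝ f x (σ x)

/-- The first-order remainder
`y^♯_{st} = δy_{st} - ∫_s^t u_r(y_r) dr - ∑_k σ_k(y_s) δz^k_{st}`. -/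
def rdeSharp {d K : ℕ} (u : ℝ → EuclideanSpace ℝ (Fin d) → EuclideanSpace ℝ (Fin d))
    (σ : Fin K → EuclideanSpace ℝ (Fin d) → EuclideanSpace ℝ (Fin d))
    (z : ℝ → EuclideanSpace ℝ (Fin K)) (y : ℝ → EuclideanSpace ℝ (Fin d)) (s t : ℝ) :
    EuclideanSpace ℝ (Fin d) :=
  y t - y s - (∫ r in s..t, u r (y r)) - ∑ k, (z t k - z s k) • σ k (y s)

/-- The second-order remainder
`y^♮_{st} = y^♯_{st} - ∑_{k,l} σ_l[σ_k](y_s) Z^{l,k}_{st}`. -/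
def rdeNatural {d K : ℕ} (u : ℝ → EuclideanSpace ℝ (Fin d) → EuclideanSpace ℝ (Fin d))
    (σ : Fin K → EuclideanSpace ℝ (Fin d) → EuclideanSpace ℝ (Fin d))
    (z : ℝ → EuclideanSpace ℝ (Fin K)) (Z : ℝ → ℝ → Fin K → Fin K → ℝ)
    (y : ℝ → EuclideanSpace ℝ (Fin d)) (s t : ℝ) : EuclideanSpace ℝ (Fin d) :=
  rdeSharp u σ z y s t - ∑ k, ∑ l, Z s t l k • lieAction (σ l) (σ k) (y s)

/-- `y` solves `dy_t = u_t(y_t) dt + ∑_k σ_k(y_t) d(z, Z)^k` on `[0, T]` at Hölder exponent `α`.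
For `α > 1/2` (the Young regime) the second level `Z` plays no role. -/
structure IsRDESolution {d K : ℕ} (T α : ℝ)
    (u : ℝ → EuclideanSpace ℝ (Fin d) → EuclideanSpace ℝ (Fin d))
    (σ : Fin K → EuclideanSpace ℝ (Fin d) → EuclideanSpace ℝ (Fin d))
    (z : ℝ → EuclideanSpace ℝ (Fin K)) (Z : ℝ → ℝ → Fin K → Fin K → ℝ)
    (y : ℝ → EuclideanSpace ℝ (Fin d)) : Prop where
  holder : IsHolderPath T α y
  sharp : IsTwoParamHolder T (2 * α) (rdeSharp u σ z y)
  natural : α ≤ 1 / 2 → IsTwoParamHolder T (3 * α) (rdeNatural u σ z Z y)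

/-- `B` is an `ℝ^K`-valued fractional Brownian motion with Hurst index `H`: a centred Gaussian
process indexed by `[0, ∞)` with covariance
`E[B_s ⊗ B_t] = (1/2) (s^{2H} + t^{2H} - |t - s|^{2H}) I` and almost surely continuous paths.
Values of `B` at negative times are irrelevant. -/
structure IsFractionalBrownianMotion {Ω : Type*} [MeasurableSpace Ω] {K : ℕ} (H : ℝ)
    (B : ℝ → Ω → EuclideanSpace ℝ (Fin K)) (P : Measure Ω) : Prop where
  gaussian : IsGaussianProcess (fun (t : ℝ≥0) ω => B t ω) P
  centred : ∀ (t : ℝ≥0) (k : Fin K), ∫ ω, B t ω k ∂P = 0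
  covariance : ∀ (s t : ℝ≥0) (k l : Fin K), ∫ ω, B s ω k * B t ω l ∂P =
    if k = l then
      ((s : ℝ) ^ (2 * H) + (t : ℝ) ^ (2 * H) - |(t : ℝ) - (s : ℝ)| ^ (2 * H)) / 2
    else 0
  continuous_paths : ∀ᵐ ω ∂P, ContinuousOn (fun t => B t ω) (Ici 0)

/-- The `i`-th point `i T 2^{-n}` of the `n`-th dyadic partition of `[0, T]`. -/
def dyadicPoint (T : ℝ) (n i : ℕ) : ℝ := i * T / 2 ^ n

/-- The scaled quadratic variation `⟨x⟩_t^{(γ),n}` along the `n`-th dyadic partition of `[0, T]`: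
the sum over the partition intervals `[t_i, t_{i+1}]` contained in `[0, t]` of
`(t_{i+1} - t_i)^γ (x_{t_{i+1}} - x_{t_i})^2`. -/
def scaledQV (T γ : ℝ) (n : ℕ) (x : ℝ → ℝ) (t : ℝ) : ℝ :=
  ∑ i ∈ Finset.range (2 ^ n) with dyadicPoint T n (i + 1) ≤ t,
    (dyadicPoint T n (i + 1) - dyadicPoint T n i) ^ γ *
      (x (dyadicPoint T n (i + 1)) - x (dyadicPoint T n i)) ^ 2

/-- `⟨⟨y⟩⟩_t^{(γ),n} = ∑ i, ⟨y^i⟩_t^{(γ),n}`. -/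
def totalScaledQV {d : ℕ} (T γ : ℝ) (n : ℕ) (y : ℝ → EuclideanSpace ℝ (Fin d)) (t : ℝ) : ℝ :=
  ∑ i, scaledQV T γ n (fun r => y r i) t

/-- The estimator `H_n = (1/2) (1 - ln S_n / ln 2)`, where
`S_n = ⟨⟨y⟩⟩_T^{(0),n+1} / ⟨⟨y⟩⟩_T^{(0),n}`. -/
def hurstEstimator {d : ℕ} (T : ℝ) (y : ℝ → EuclideanSpace ℝ (Fin d)) (n : ℕ) : ℝ :=
  1 / 2 * (1 - Real.log (totalScaledQV T 0 (n + 1) y T / totalScaledQV T 0 n y T) / Real.log 2)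

/-- The rate `δ_n`. -/
def dyadicRate (H : ℝ) (n : ℕ) : ℝ :=
  if H ≤ 1 / 2 then (2 : ℝ) ^ (-(n : ℝ) / 2) * √(n : ℝ)
  else (2 : ℝ) ^ (-(n : ℝ) * (1 - H)) * √(n : ℝ)

/-- The Gubinelli derivative `f(y)' = (σ_k[f](y))_k` of `f(y)`. -/
def gubinelliDeriv {d K : ℕ} (σ : Fin K → EuclideanSpace ℝ (Fin d) → EuclideanSpace ℝ (Fin d))
    (f : EuclideanSpace ℝ (Fin d) → ℝ) (y : ℝ → EuclideanSpace ℝ (Fin d)) (t : ℝ) :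
    EuclideanSpace ℝ (Fin K) :=
  WithLp.toLp 2 (fun k => lieAction (σ k) f (y t))

/-- The remainder `f(y)^♯_{st} = δf(y)_{st} - f(y)'_s δz_{st}` of `f(y)` as a path controlled by
`z`. -/
def gubinelliRemainder {d K : ℕ}
    (σ : Fin K → EuclideanSpace ℝ (Fin d) → EuclideanSpace ℝ (Fin d))
    (f : EuclideanSpace ℝ (Fin d) → ℝ) (z : ℝ → EuclideanSpace ℝ (Fin K))
    (y : ℝ → EuclideanSpace ℝ (Fin d)) (s t : ℝ) : ℝ :=
  f (y t) - f (y s) - ∑ k, gubinelliDeriv σ f y s k * (z t k - z s k)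

end

/-! ### Moments of Gaussian variables -/

namespace ProbabilityTheory

/-! Write `μ = min (1/2) (1 - H)`, so that `δ_n = 2^{-nμ} √n`, and let `h = T 2^{-n}` be the mesh.
The core is that the quadratic variation of `f(y)`, scaled with the true exponent `1 - 2H`,
converges pathwise and uniformly in `t` at rate `2^{-nr}` for every `r < Hμ`
(`ae_exists_abs_scaledQV_sub_le`).

For `β < H` close to `H`, the increments of `f(y)` equal `∑ σ_k[f](y_s) δB^k` up to order `ρ = min
(2β) 1`. Dropping the remainder costs `h^{β+ρ-2H}`, and the compensator of what is left is a Riemann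
sum. There remain weighted sums of centred products of increments of `B`. The weights depend on `B`,
but they are `β`-Hölder, so they are frozen on `2^{⌊μn⌋}` dyadic blocks (`abs_sum_mul_le_blockSum`).
Oscillation inside the blocks costs `2^{-nμβ}`, up to a power that is small when `β` is near `H`.

The frozen part only needs block sums of the noise. By Isserlis their variance is twice the squared
Hilbert-Schmidt norm of the covariance of the increments. Its off-diagonal entries have one sign, so
the absolute sum reduces to the variance of the total increment; `N` increments then fluctuate by at
most order `h^{2H} N^{max (1/2) H}` in mean. Markov and Borel-Cantelli turn this into any rate
`2^{-nq}` with `q < (1 - μ)μ`, and `1 - μ ≥ H`.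

Applied to the coordinates of `y`, this gives a total variation with positive limit on the event
considered. Logarithms of ratios then converge equally fast, hence so does `H_n`. Replacing `H` by
`H_n` in the scaling multiplies the error by `|log h|`, which is of order `n`. As `r` may exceed
`max (H - ε) 0 * μ`, a spare geometric factor remains and beats all random constants. -/

theorem integral_pow_four_gaussianReal : ∫ x : ℝ, x ^ 4 ∂(gaussianReal 0 1) = 3 := by
  -- The moment is the fourth derivative at `0` of the moment generating function `exp (t² / 2)`;
  -- `e1` to `e4` are its successive derivatives.
  have h := iteratedDeriv_mgf_zero (X := (id : ℝ → ℝ)) (μ := gaussianReal 0 1)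
    (by rw [integrableExpSet_id_gaussianReal]; simp) 4
  simp only [Pi.pow_apply, id] at h
  rw [← h, mgf_id_gaussianReal]
  have e0 : (fun t : ℝ => Real.exp (0 * t + ((1 : ℝ≥0) : ℝ) * t ^ 2 / 2))
      = fun t => Real.exp (t ^ 2 / 2) := by ext t; simp
  have hE : ∀ t : ℝ, HasDerivAt (fun t => Real.exp (t ^ 2 / 2)) (Real.exp (t ^ 2 / 2) * t) t := by
    intro t
    have := ((hasDerivAt_pow 2 t).div_const 2).exp
    simpa using this
  have e1 : deriv (fun t : ℝ => Real.exp (t ^ 2 / 2)) = fun t => Real.exp (t ^ 2 / 2) * t :=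
    funext fun t => (hE t).deriv
  have e2 : deriv (fun t : ℝ => Real.exp (t ^ 2 / 2) * t)
      = fun t => Real.exp (t ^ 2 / 2) * (t ^ 2 + 1) := by
    ext t
    rw [((hE t).fun_mul (hasDerivAt_id' t)).deriv]; ring
  have e3 : deriv (fun t : ℝ => Real.exp (t ^ 2 / 2) * (t ^ 2 + 1))
      = fun t => Real.exp (t ^ 2 / 2) * (t ^ 3 + 3 * t) := by
    ext t
    rw [((hE t).fun_mul ((hasDerivAt_pow 2 t).add_const 1)).deriv]; simp; ring
  have e4 : deriv (fun t : ℝ => Real.exp (t ^ 2 / 2) * (t ^ 3 + 3 * t))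
      = fun t => Real.exp (t ^ 2 / 2) * (t ^ 4 + 6 * t ^ 2 + 3) := by
    ext t
    rw [((hE t).fun_mul ((hasDerivAt_pow 3 t).fun_add ((hasDerivAt_id' t).const_mul 3))).deriv]; simp; ring
  rw [e0]
  simp only [iteratedDeriv_succ, iteratedDeriv_zero, e1, e2, e3, e4]
  simp

section Gaussian

variable {Ω : Type*} [MeasurableSpace Ω] {P : Measure Ω}

theorem HasGaussianLaw.integrable_pow {X : Ω → ℝ} (hX : HasGaussianLaw X P) (p : ℕ) :
    Integrable (fun ω => X ω ^ p) P := by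
  have := hX.isProbabilityMeasure
  refine (integrable_norm_iff (hX.aemeasurable.pow_const p).aestronglyMeasurable).1 ?_
  simpa using (hX.memLp (p := p) (by simp)).integrable_norm_pow'

/-- A centred Gaussian variable has the law of its standard deviation times a standard one. Fourth
moments serve the variances, high moments the Hölder regularity of `B`. -/
theorem HasGaussianLaw.integral_pow {X : Ω → ℝ} (hX : HasGaussianLaw X P)
    (h0 : ∫ ω, X ω ∂P = 0) (p : ℕ) :
    ∫ ω, X ω ^ p ∂P = √(∫ ω, X ω ^ 2 ∂P) ^ p * ∫ x : ℝ, x ^ p ∂(gaussianReal 0 1) := by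
  have := hX.isProbabilityMeasure
  have hv : Var[X; P] = ∫ ω, X ω ^ 2 ∂P := by
    rw [variance_of_integral_eq_zero hX.aemeasurable h0]
  have hn : 0 ≤ ∫ ω, X ω ^ 2 ∂P := integral_nonneg fun ω => sq_nonneg _
  have hlaw : P.map X = (gaussianReal 0 1).map (fun x => √(∫ ω, X ω ^ 2 ∂P) * x) := by
    rw [hX.map_eq_gaussianReal, h0, hv, gaussianReal_map_const_mul]
    congr 1
    · simp
    · ext
      simp [hn]
  have e1 : ∫ ω, X ω ^ p ∂P = ∫ x, x ^ p ∂(P.map X) :=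
    (integral_map (f := fun x : ℝ => x ^ p) hX.aemeasurable (by fun_prop)).symm
  rw [e1, hlaw, integral_map (by fun_prop) (by fun_prop)]
  simp_rw [mul_pow]
  rw [integral_const_mul]

theorem HasGaussianLaw.integral_pow_four {X : Ω → ℝ} (hX : HasGaussianLaw X P)
    (h0 : ∫ ω, X ω ∂P = 0) : ∫ ω, X ω ^ 4 ∂P = 3 * (∫ ω, X ω ^ 2 ∂P) ^ 2 := by
  have hn : 0 ≤ ∫ ω, X ω ^ 2 ∂P := integral_nonneg fun ω => sq_nonneg _
  rw [hX.integral_pow h0, integral_pow_four_gaussianReal]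
  have : √(∫ ω, X ω ^ 2 ∂P) ^ 4 = (√(∫ ω, X ω ^ 2 ∂P) ^ 2) ^ 2 := by ring
  rw [this, Real.sq_sqrt hn]; ring

/-- Isserlis' formula for the squares of two jointly Gaussian variables. -/
theorem HasGaussianLaw.integral_sq_mul_sq {X Y : Ω → ℝ}
    (hXY : HasGaussianLaw (fun ω => (X ω, Y ω)) P)
    (hX : ∫ ω, X ω ∂P = 0) (hY : ∫ ω, Y ω ∂P = 0) :
    Integrable (fun ω => X ω * Y ω) P ∧ Integrable (fun ω => X ω ^ 2 * Y ω ^ 2) P ∧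
    ∫ ω, X ω ^ 2 * Y ω ^ 2 ∂P
      = (∫ ω, X ω ^ 2 ∂P) * (∫ ω, Y ω ^ 2 ∂P) + 2 * (∫ ω, X ω * Y ω ∂P) ^ 2 := by
  have gX := hXY.fst
  have gY := hXY.snd
  have gA := hXY.fun_add
  have gS := hXY.fun_sub
  have hA0 : ∫ ω, X ω + Y ω ∂P = 0 := by
    rw [integral_add gX.integrable gY.integrable, hX, hY, add_zero]
  have hS0 : ∫ ω, X ω - Y ω ∂P = 0 := by
    rw [integral_sub gX.integrable gY.integrable, hX, hY, sub_zero]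
  have iXY : Integrable (fun ω => X ω * Y ω) P := by
    refine (((gA.integrable_pow 2).sub (gS.integrable_pow 2)).const_mul (1 / 4)).congr ?_
    filter_upwards with ω
    simp only [Pi.sub_apply]; ring
  have hA2 : ∫ ω, (X ω + Y ω) ^ 2 ∂P
      = ∫ ω, X ω ^ 2 ∂P + 2 * (∫ ω, X ω * Y ω ∂P) + ∫ ω, Y ω ^ 2 ∂P := by
    rw [← integral_const_mul, ← integral_add (gX.integrable_pow 2) (iXY.const_mul 2),
      ← integral_add ((gX.integrable_pow 2).fun_add (iXY.const_mul 2)) (gY.integrable_pow 2)]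
    congr 1; ext ω; ring
  have hS2 : ∫ ω, (X ω - Y ω) ^ 2 ∂P
      = ∫ ω, X ω ^ 2 ∂P - 2 * (∫ ω, X ω * Y ω ∂P) + ∫ ω, Y ω ^ 2 ∂P := by
    rw [← integral_const_mul, ← integral_sub (gX.integrable_pow 2) (iXY.const_mul 2),
      ← integral_add ((gX.integrable_pow 2).sub' (iXY.const_mul 2)) (gY.integrable_pow 2)]
    congr 1; ext ω; ring
  -- Polarisation reduces the mixed moment to fourth moments of the Gaussian variables `X ± Y`, `X`
  -- and `Y`.
  have e : ∀ ω, X ω ^ 2 * Y ω ^ 2 = (1 / 12) * ((X ω + Y ω) ^ 4 + (X ω - Y ω) ^ 4)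
      - (1 / 6) * (X ω ^ 4 + Y ω ^ 4) := fun ω => by ring
  have iA := (gA.integrable_pow 4).fun_add (gS.integrable_pow 4)
  have iB := (gX.integrable_pow 4).fun_add (gY.integrable_pow 4)
  refine ⟨iXY, ?_, ?_⟩
  · refine ((iA.const_mul (1 / 12)).sub (iB.const_mul (1 / 6))).congr ?_
    filter_upwards with ω
    rw [e]; rfl
  · simp_rw [e]
    rw [integral_sub (iA.const_mul _) (iB.const_mul _), integral_const_mul, integral_const_mul,
      integral_add (gA.integrable_pow 4) (gS.integrable_pow 4),
      integral_add (gX.integrable_pow 4) (gY.integrable_pow 4), gA.integral_pow_four hA0,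
      gS.integral_pow_four hS0, gX.integral_pow_four hX, gY.integral_pow_four hY, hA2, hS2]
    ring

/-- The second moment of a centred sum of squares of jointly Gaussian variables. -/
theorem IsGaussianProcess.integral_sum_sq_sub_sq {ι : Type*} {X : ι → Ω → ℝ}
    (hX : IsGaussianProcess X P) (h0 : ∀ i, ∫ ω, X i ω ∂P = 0) {v : ℝ}
    (hv : ∀ i, ∫ ω, X i ω ^ 2 ∂P = v) (I : Finset ι) :
    Integrable (fun ω => (∑ i ∈ I, (X i ω ^ 2 - v)) ^ 2) P ∧
    ∫ ω, (∑ i ∈ I, (X i ω ^ 2 - v)) ^ 2 ∂P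
      = 2 * ∑ i ∈ I, ∑ j ∈ I, (∫ ω, X i ω * X j ω ∂P) ^ 2 := by
  have := hX.isProbabilityMeasure
  have key := fun i j => (hX.hasGaussianLaw_prodMk (s := i) (t := j)).integral_sq_mul_sq
    (h0 i) (h0 j)
  have g := fun i => hX.hasGaussianLaw_eval i
  have hi : ∀ i j, Integrable (fun ω => (X i ω ^ 2 - v) * (X j ω ^ 2 - v)) P := by
    intro i j
    refine ((((key i j).2.1).sub (((g i).integrable_pow 2).const_mul v)).sub
      ((((g j).integrable_pow 2).sub (integrable_const v)).const_mul v)).congr ?_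
    filter_upwards with ω
    simp only [Pi.sub_apply]; ring
  have e : ∀ ω, (∑ i ∈ I, (X i ω ^ 2 - v)) ^ 2
      = ∑ i ∈ I, ∑ j ∈ I, (X i ω ^ 2 - v) * (X j ω ^ 2 - v) := by
    intro ω; rw [sq, Finset.sum_mul_sum]
  simp_rw [e]
  refine ⟨integrable_finsetSum _ fun i _ => integrable_finsetSum _ fun j _ => hi i j, ?_⟩
  rw [integral_finsetSum _ fun i _ => integrable_finsetSum _ fun j _ => hi i j, Finset.mul_sum]
  refine Finset.sum_congr rfl fun i _ => ?_
  rw [integral_finsetSum _ fun j _ => hi i j, Finset.mul_sum]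
  refine Finset.sum_congr rfl fun j _ => ?_
  have e2 : ∀ ω, (X i ω ^ 2 - v) * (X j ω ^ 2 - v)
      = X i ω ^ 2 * X j ω ^ 2 - v * X i ω ^ 2 - v * (X j ω ^ 2 - v) := fun ω => by ring
  simp_rw [e2]
  rw [integral_sub (((key i j).2.1).sub' (((g i).integrable_pow 2).const_mul v))
      ((((g j).integrable_pow 2).sub' (integrable_const v)).const_mul v),
    integral_sub (key i j).2.1 (((g i).integrable_pow 2).const_mul v), integral_const_mul,
    integral_const_mul, integral_sub ((g j).integrable_pow 2) (integrable_const v),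
    (key i j).2.2, hv, hv]
  simp

end Gaussian

end ProbabilityTheory

/-! ### Increments of fractional Brownian motion -/

/-- The increment over `[p.1, p.2]` of the projection of `B` on the direction `a`. -/
noncomputable def projIncrement {Ω : Type*} {K : ℕ} (B : ℝ → Ω → EuclideanSpace ℝ (Fin K))
    (a : Fin K → ℝ) (p : ℝ≥0 × ℝ≥0) (ω : Ω) : ℝ :=
  ∑ k, a k * (B p.2 ω k - B p.1 ω k)

/-- The `i`-th increment along the grid of step `h` started at the `b`-th grid point. -/
noncomputable def gridPair (h : ℝ≥0) (b i : ℕ) : ℝ≥0 × ℝ≥0 :=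
  (((b + i : ℕ) : ℝ≥0) * h, ((b + i + 1 : ℕ) : ℝ≥0) * h)

/-- Telescoping. It identifies the sum of all covariances in a block with the variance of one long
increment. -/
theorem sum_projIncrement_gridPair {Ω : Type*} {K : ℕ}
    (B : ℝ → Ω → EuclideanSpace ℝ (Fin K)) (a : Fin K → ℝ) (h : ℝ≥0) (b N : ℕ) (ω : Ω) :
    ∑ i ∈ Finset.range N, projIncrement B a (gridPair h b i) ω
      = projIncrement B a ((b : ℝ≥0) * h, ((b + N : ℕ) : ℝ≥0) * h) ω := by
  simp only [projIncrement, gridPair]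
  rw [Finset.sum_comm]
  refine Finset.sum_congr rfl fun k _ => ?_
  rw [← Finset.mul_sum]
  congr 1
  exact Finset.sum_range_sub (fun i => B (((b + i : ℕ) : ℝ≥0) * h : ℝ≥0) ω k) N

namespace IsFractionalBrownianMotion

variable {Ω : Type*} [MeasurableSpace Ω] {P : Measure Ω} {K : ℕ} {H : ℝ}
  {B : ℝ → Ω → EuclideanSpace ℝ (Fin K)}

theorem isGaussianProcess_projIncrement (hB : IsFractionalBrownianMotion H B P)
    (a : Fin K → ℝ) : IsGaussianProcess (projIncrement B a) P := by
  classical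
  refine hB.gaussian.of_isGaussianProcess fun p => ⟨{p.1, p.2},
    ∑ k, a k • ((EuclideanSpace.proj k : EuclideanSpace ℝ (Fin K) →L[ℝ] ℝ) ∘L
      (ContinuousLinearMap.proj (R := ℝ)
          (φ := fun _ : ↥({p.1, p.2} : Finset ℝ≥0) => EuclideanSpace ℝ (Fin K)) ⟨p.2, by simp⟩
        - ContinuousLinearMap.proj ⟨p.1, by simp⟩)), fun ω => ?_⟩
  simp [projIncrement]

theorem hasGaussianLaw_coord (hB : IsFractionalBrownianMotion H B P) (t : ℝ≥0) (k : Fin K) :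
    HasGaussianLaw (fun ω => B t ω k) P :=
  (hB.gaussian.hasGaussianLaw_eval t).map_fun (EuclideanSpace.proj k)

theorem integral_projIncrement (hB : IsFractionalBrownianMotion H B P)
    (a : Fin K → ℝ) (p : ℝ≥0 × ℝ≥0) : ∫ ω, projIncrement B a p ω ∂P = 0 := by
  have hi := fun t k => (hB.hasGaussianLaw_coord t k).integrable
  simp only [projIncrement]
  rw [integral_finsetSum _ fun k _ => ((hi _ k).sub' (hi _ k)).const_mul _]
  refine Finset.sum_eq_zero fun k _ => ?_
  rw [integral_const_mul, integral_sub (hi _ k) (hi _ k), hB.centred, hB.centred]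
  simp

theorem integral_projIncrement_mul (hB : IsFractionalBrownianMotion H B P)
    (a : Fin K → ℝ) (p q : ℝ≥0 × ℝ≥0) :
    ∫ ω, projIncrement B a p ω * projIncrement B a q ω ∂P
      = (∑ k, a k ^ 2) * ((|(q.2 : ℝ) - p.1| ^ (2 * H) + |(q.1 : ℝ) - p.2| ^ (2 * H)
          - |(q.2 : ℝ) - p.2| ^ (2 * H) - |(q.1 : ℝ) - p.1| ^ (2 * H)) / 2) := by
  have hm := fun t k => (hB.hasGaussianLaw_coord t k).memLp_two
  have hi : ∀ s t k l, Integrable (fun ω => B (s : ℝ≥0) ω k * B (t : ℝ≥0) ω l) P :=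
    fun s t k l => (hm s k).integrable_mul (hm t l)
  have e : ∀ ω, projIncrement B a p ω * projIncrement B a q ω
      = ∑ k, ∑ l, (a k * a l) * (B p.2 ω k * B q.2 ω l - B p.2 ω k * B q.1 ω l
          - (B p.1 ω k * B q.2 ω l - B p.1 ω k * B q.1 ω l)) := by
    intro ω
    simp only [projIncrement, Finset.sum_mul_sum]
    refine Finset.sum_congr rfl fun k _ => Finset.sum_congr rfl fun l _ => by ring
  have hI : ∀ k l, Integrable (fun ω => (a k * a l) * (B p.2 ω k * B q.2 ω l
      - B p.2 ω k * B q.1 ω l - (B p.1 ω k * B q.2 ω l - B p.1 ω k * B q.1 ω l))) P :=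
    fun k l => (((hi _ _ _ _).sub' (hi _ _ _ _)).sub'
      ((hi _ _ _ _).sub' (hi _ _ _ _))).const_mul _
  simp_rw [e]
  rw [integral_finsetSum _ fun k _ => integrable_finsetSum _ fun l _ => hI k l, Finset.sum_mul]
  refine Finset.sum_congr rfl fun k _ => ?_
  rw [integral_finsetSum _ fun l _ => hI k l]
  rw [Finset.sum_eq_single k]
  · rw [integral_const_mul, integral_sub ((hi _ _ _ _).sub' (hi _ _ _ _))
      ((hi _ _ _ _).sub' (hi _ _ _ _)), integral_sub (hi _ _ _ _) (hi _ _ _ _),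
      integral_sub (hi _ _ _ _) (hi _ _ _ _)]
    simp only [hB.covariance, if_true]
    ring
  · intro l _ hl
    rw [integral_const_mul, integral_sub ((hi _ _ _ _).sub' (hi _ _ _ _))
      ((hi _ _ _ _).sub' (hi _ _ _ _)), integral_sub (hi _ _ _ _) (hi _ _ _ _),
      integral_sub (hi _ _ _ _) (hi _ _ _ _)]
    simp only [hB.covariance, if_neg hl.symm]
    ring
  · simp

theorem integral_projIncrement_sq (hB : IsFractionalBrownianMotion H B P) (hH : 0 < H)
    (a : Fin K → ℝ) (p : ℝ≥0 × ℝ≥0) :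
    ∫ ω, projIncrement B a p ω ^ 2 ∂P = (∑ k, a k ^ 2) * |(p.2 : ℝ) - p.1| ^ (2 * H) := by
  have := hB.integral_projIncrement_mul a p p
  simp_rw [← sq] at this
  rw [this, sub_self, sub_self, abs_zero, Real.zero_rpow (by positivity), abs_sub_comm (p.1 : ℝ)]
  ring

theorem integral_gridPair_mul (hB : IsFractionalBrownianMotion H B P)
    (a : Fin K → ℝ) (h : ℝ≥0) (b i j : ℕ) :
    ∫ ω, projIncrement B a (gridPair h b i) ω * projIncrement B a (gridPair h b j) ω ∂P
      = (∑ k, a k ^ 2) * ((h : ℝ) ^ (2 * H) * ((|(j : ℝ) - i + 1| ^ (2 * H)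
          + |(j : ℝ) - i - 1| ^ (2 * H) - 2 * |(j : ℝ) - i| ^ (2 * H)) / 2)) := by
  have key : ∀ x y : ℝ, |x * h - y * h| ^ (2 * H) = (h : ℝ) ^ (2 * H) * |x - y| ^ (2 * H) := by
    intro x y
    rw [← sub_mul, abs_mul, Real.mul_rpow (abs_nonneg _) (abs_nonneg _),
      abs_of_nonneg h.coe_nonneg, mul_comm]
  rw [hB.integral_projIncrement_mul]
  simp only [gridPair, NNReal.coe_mul, NNReal.coe_natCast, key]
  push_cast
  ring_nf

/-- Midpoint concavity or convexity of `t ↦ t ^ p` on `[0, ∞)`, where `|x| ≥ 1` keeps the three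
points. With `p = 2H` this fixes the sign of the correlation of distinct increments: negative for `H
≤ 1/2`, positive for `H ≥ 1/2`, in the weak sense. -/
theorem second_difference_rpow {p : ℝ} (hp : 0 ≤ p) {x : ℝ} (hx : 1 ≤ |x|) :
    (p ≤ 1 → |x + 1| ^ p + |x - 1| ^ p - 2 * |x| ^ p ≤ 0) ∧
    (1 ≤ p → 0 ≤ |x + 1| ^ p + |x - 1| ^ p - 2 * |x| ^ p) := by
  wlog h0 : 0 ≤ x generalizing x
  · have := this (x := -x) (by rwa [abs_neg]) (by linarith)
    have e1 : |-x + 1| = |x - 1| := by rw [← abs_neg]; ring_nf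
    have e2 : |-x - 1| = |x + 1| := by rw [← abs_neg]; ring_nf
    rw [e1, e2, abs_neg] at this
    constructor <;> intro hp1
    · linarith [this.1 hp1]
    · linarith [this.2 hp1]
  rw [abs_of_nonneg h0] at *
  rw [abs_of_nonneg (by linarith : 0 ≤ x + 1), abs_of_nonneg (by linarith : 0 ≤ x - 1)]
  have m1 : x + 1 ∈ Ici (0 : ℝ) := by simp; linarith
  have m2 : x - 1 ∈ Ici (0 : ℝ) := by simp; linarith
  have e : (1 / 2 : ℝ) • (x + 1) + (1 / 2 : ℝ) • (x - 1) = x := by simp; ring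
  constructor <;> intro hp1
  · have := (Real.concaveOn_rpow hp hp1).2 m1 m2 (by norm_num : (0 : ℝ) ≤ 1 / 2)
      (by norm_num : (0 : ℝ) ≤ 1 / 2) (by norm_num)
    simp only [e] at this
    simp only [smul_eq_mul] at this
    linarith
  · have := (convexOn_rpow hp1).2 m1 m2 (by norm_num : (0 : ℝ) ≤ 1 / 2)
      (by norm_num : (0 : ℝ) ≤ 1 / 2) (by norm_num)
    simp only [e] at this
    simp only [smul_eq_mul] at this
    linarith

/-- A bound for the Hilbert-Schmidt norm of a covariance whose off-diagonal entries have a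
constant sign. -/
theorem sum_sq_le_of_sign {c : ℕ → ℕ → ℝ} {v S : ℝ} (N : ℕ) (hv : ∀ i, c i i = v)
    (hle : ∀ i j, |c i j| ≤ v) (hS : ∑ i ∈ Finset.range N, ∑ j ∈ Finset.range N, c i j = S)
    (hS0 : 0 ≤ S)
    (hsign : (∀ i j, i ≠ j → c i j ≤ 0) ∨ (∀ i j, i ≠ j → 0 ≤ c i j)) :
    ∑ i ∈ Finset.range N, ∑ j ∈ Finset.range N, c i j ^ 2 ≤ v * (2 * (N * v) + S) := by
  have hv0 : 0 ≤ v := (abs_nonneg _).trans (hle 0 0)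
  -- A constant sign makes the absolute sum computable: it is `2Nv - S` for nonpositive off-diagonal
  -- entries and `S` for nonnegative ones. One factor of each square is then bounded by `v`.
  have habs : ∑ i ∈ Finset.range N, ∑ j ∈ Finset.range N, |c i j| ≤ 2 * (N * v) + S := by
    rcases hsign with h | h
    · have : ∀ i j, |c i j| ≤ (if i = j then 2 * v else 0) - c i j := by
        intro i j
        split_ifs with hij
        · subst hij; rw [hv, abs_of_nonneg hv0]; linarith
        · rw [abs_of_nonpos (h i j hij)]; linarith
      calc _ ≤ ∑ i ∈ Finset.range N, ∑ j ∈ Finset.range N,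
            ((if i = j then 2 * v else 0) - c i j) :=
            Finset.sum_le_sum fun i _ => Finset.sum_le_sum fun j _ => this i j
        _ = 2 * (N * v) - S := by
            simp_rw [Finset.sum_sub_distrib]
            rw [hS, Finset.sum_congr rfl (g := fun _ => 2 * v) fun i hi => by
              rw [Finset.sum_ite_eq, if_pos hi]]
            simp; ring
        _ ≤ _ := by linarith
    · have : ∀ i j, |c i j| = c i j := fun i j => by
        rcases eq_or_ne i j with hij | hij
        · subst hij; rw [hv, abs_of_nonneg hv0]
        · exact abs_of_nonneg (h i j hij)
      simp_rw [this]
      rw [hS]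
      have : 0 ≤ (N : ℝ) * v := by positivity
      linarith
  calc _ ≤ ∑ i ∈ Finset.range N, ∑ j ∈ Finset.range N, v * |c i j| := by
        refine Finset.sum_le_sum fun i _ => Finset.sum_le_sum fun j _ => ?_
        rw [← sq_abs, sq]
        exact mul_le_mul_of_nonneg_right (hle i j) (abs_nonneg _)
    _ = v * ∑ i ∈ Finset.range N, ∑ j ∈ Finset.range N, |c i j| := by
        simp_rw [Finset.mul_sum]
    _ ≤ _ := mul_le_mul_of_nonneg_left habs hv0

theorem integral_sq_gridPair (hB : IsFractionalBrownianMotion H B P) (hH : 0 < H)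
    (a : Fin K → ℝ) (h : ℝ≥0) (b i : ℕ) :
    ∫ ω, projIncrement B a (gridPair h b i) ω ^ 2 ∂P = (∑ k, a k ^ 2) * (h : ℝ) ^ (2 * H) := by
  have := hB.integral_gridPair_mul a h b i i
  simp_rw [← sq] at this
  rw [this]
  simp [Real.zero_rpow (by positivity : (2 * H) ≠ 0)]

/-- The variance is at most `2v(2Nv + vN^{2H}) ≤ 6v² N^{2 max(1/2, H)}`, and `9 = 3²` leaves room.
The bound is not sharp for `1/2 < H < 3/4`, but it is what the rate `δ_n` requires. -/
theorem integral_sq_sum_gridPair_le (hB : IsFractionalBrownianMotion H B P) (hH : 0 < H)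
    (a : Fin K → ℝ) (h : ℝ≥0) (b N : ℕ) (hN : 1 ≤ N) :
    ∫ ω, (∑ i ∈ Finset.range N, (projIncrement B a (gridPair h b i) ω ^ 2
        - (∑ k, a k ^ 2) * (h : ℝ) ^ (2 * H))) ^ 2 ∂P
      ≤ (3 * ((∑ k, a k ^ 2) * (h : ℝ) ^ (2 * H)) * (N : ℝ) ^ max (1 / 2) H) ^ 2 := by
  have hprob := hB.gaussian.isProbabilityMeasure
  have hG : IsGaussianProcess (fun i => projIncrement B a (gridPair h b i)) P :=
    (hB.isGaussianProcess_projIncrement a).comp_right (gridPair h b)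
  set v := (∑ k, a k ^ 2) * (h : ℝ) ^ (2 * H) with hvdef
  have hA : 0 ≤ ∑ k, a k ^ 2 := Finset.sum_nonneg fun k _ => sq_nonneg _
  have hv0 : 0 ≤ v := by positivity
  have hsq := fun i => hB.integral_sq_gridPair hH a h b i
  rw [(hG.integral_sum_sq_sub_sq (fun i => hB.integral_projIncrement a _) hsq
    (Finset.range N)).2]
  have hm := fun i => (hG.hasGaussianLaw_eval i).memLp_two
  have hI : ∀ i j, Integrable (fun ω => projIncrement B a (gridPair h b i) ω
      * projIncrement B a (gridPair h b j) ω) P := fun i j => (hm i).integrable_mul (hm j)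
  have hI2 := fun i => (hG.hasGaussianLaw_eval i).integrable_pow 2
  have hN1 : (1 : ℝ) ≤ N := by exact_mod_cast hN
  have key := sum_sq_le_of_sign (c := fun i j => ∫ ω, projIncrement B a (gridPair h b i) ω
      * projIncrement B a (gridPair h b j) ω ∂P) (v := v) (S := v * (N : ℝ) ^ (2 * H)) N
    (fun i => by simp_rw [← sq]; exact hsq i) ?_ ?_ (by positivity) ?_
  · have hpow : (N : ℝ) ≤ ((N : ℝ) ^ max (1 / 2) H) ^ 2 ∧
        (N : ℝ) ^ (2 * H) ≤ ((N : ℝ) ^ max (1 / 2) H) ^ 2 := by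
      rw [← Real.rpow_natCast ((N : ℝ) ^ max (1 / 2) H), ← Real.rpow_mul (by positivity)]
      constructor
      · conv_lhs => rw [← Real.rpow_one (N : ℝ)]
        refine Real.rpow_le_rpow_of_exponent_le hN1 ?_
        push_cast
        linarith [le_max_left (1 / 2) H]
      · refine Real.rpow_le_rpow_of_exponent_le hN1 ?_
        push_cast
        linarith [le_max_right (1 / 2) H]
    have e1 := mul_le_mul_of_nonneg_left hpow.1 (by positivity : 0 ≤ v ^ 2)
    have e2 := mul_le_mul_of_nonneg_left hpow.2 (by positivity : 0 ≤ v ^ 2)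
    have e3 : 0 ≤ v ^ 2 * ((N : ℝ) ^ max (1 / 2) H) ^ 2 := by positivity
    have e4 : (3 * v * (N : ℝ) ^ max (1 / 2) H) ^ 2
        = 9 * (v ^ 2 * ((N : ℝ) ^ max (1 / 2) H) ^ 2) := by ring
    rw [e4]
    refine (mul_le_mul_of_nonneg_left key zero_le_two).trans ?_
    nlinarith
  · intro i j
    have hxy : ∀ x y : ℝ, |x * y| ≤ (x ^ 2 + y ^ 2) / 2 := fun x y => by
      rw [abs_le]; constructor <;> nlinarith [sq_nonneg (x + y), sq_nonneg (x - y)]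
    calc _ ≤ ∫ ω, |projIncrement B a (gridPair h b i) ω * projIncrement B a (gridPair h b j) ω| ∂P :=
          abs_integral_le_integral_abs
      _ ≤ ∫ ω, (projIncrement B a (gridPair h b i) ω ^ 2
          + projIncrement B a (gridPair h b j) ω ^ 2) / 2 ∂P :=
          integral_mono (hI i j).abs (((hI2 i).fun_add (hI2 j)).div_const 2) fun ω => hxy _ _
      _ = v := by
          rw [integral_div]
          have := integral_add (hI2 i) (hI2 j)
          rw [this, hsq, hsq]; ring
  -- The sum of all covariances is the second moment of the increment over the whole block, of
  -- length `N h`.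
  · rw [Finset.sum_congr rfl fun i _ => (integral_finsetSum _ fun j _ => hI i j).symm,
      ← integral_finsetSum _ fun i _ => integrable_finsetSum _ fun j _ => hI i j]
    simp_rw [← Finset.sum_mul_sum, ← sq, sum_projIncrement_gridPair]
    rw [hB.integral_projIncrement_sq hH]
    have : (((b + N : ℕ) : ℝ≥0) * h : ℝ≥0) - (((b : ℝ≥0) * h : ℝ≥0) : ℝ) = (N : ℝ) * h := by
      push_cast; ring
    simp only [this]
    rw [abs_of_nonneg (by positivity), Real.mul_rpow (by positivity) (by positivity), hvdef]
    ring
  · have hx : ∀ i j : ℕ, i ≠ j → 1 ≤ |(j : ℝ) - i| := by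
      intro i j hij
      have : (1 : ℤ) ≤ |(j : ℤ) - i| := Int.one_le_abs (by omega)
      exact_mod_cast this
    have hp : 0 ≤ (h : ℝ) ^ (2 * H) := by positivity
    rcases le_total (2 * H) 1 with h1 | h1
    · refine Or.inl fun i j hij => ?_
      simp only [hB.integral_gridPair_mul]
      have := (second_difference_rpow (by positivity : 0 ≤ 2 * H) (hx i j hij)).1 h1
      exact mul_nonpos_of_nonneg_of_nonpos hA
        (mul_nonpos_of_nonneg_of_nonpos hp (by linarith))
    · refine Or.inr fun i j hij => ?_
      simp only [hB.integral_gridPair_mul]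
      have := (second_difference_rpow (by positivity : 0 ≤ 2 * H) (hx i j hij)).2 h1
      exact mul_nonneg hA (mul_nonneg hp (by linarith))

theorem integral_abs_sum_gridPair_le (hB : IsFractionalBrownianMotion H B P) (hH : 0 < H)
    (a : Fin K → ℝ) (h : ℝ≥0) (b N : ℕ) (hN : 1 ≤ N) :
    Integrable (fun ω => |∑ i ∈ Finset.range N, (projIncrement B a (gridPair h b i) ω ^ 2
        - (∑ k, a k ^ 2) * (h : ℝ) ^ (2 * H))|) P ∧
    ∫ ω, |∑ i ∈ Finset.range N, (projIncrement B a (gridPair h b i) ω ^ 2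
        - (∑ k, a k ^ 2) * (h : ℝ) ^ (2 * H))| ∂P
      ≤ 3 * ((∑ k, a k ^ 2) * (h : ℝ) ^ (2 * H)) * (N : ℝ) ^ max (1 / 2) H := by
  have hprob := hB.gaussian.isProbabilityMeasure
  have hG : IsGaussianProcess (fun i => projIncrement B a (gridPair h b i)) P :=
    (hB.isGaussianProcess_projIncrement a).comp_right (gridPair h b)
  have hA : 0 ≤ ∑ k, a k ^ 2 := Finset.sum_nonneg fun k _ => sq_nonneg _
  have hI2 := fun i => (hG.hasGaussianLaw_eval i).integrable_pow 2
  have hint : Integrable (fun ω => ∑ i ∈ Finset.range N,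
      (projIncrement B a (gridPair h b i) ω ^ 2 - (∑ k, a k ^ 2) * (h : ℝ) ^ (2 * H))) P :=
    integrable_finsetSum _ fun i _ => (hI2 i).sub' (integrable_const _)
  have hsq := (hG.integral_sum_sq_sub_sq (fun i => hB.integral_projIncrement a _)
    (fun i => hB.integral_sq_gridPair hH a h b i) (Finset.range N)).1
  have hL : MemLp (fun ω => |∑ i ∈ Finset.range N,
      (projIncrement B a (gridPair h b i) ω ^ 2 - (∑ k, a k ^ 2) * (h : ℝ) ^ (2 * H))|) 2 P :=
    ((memLp_two_iff_integrable_sq hint.aestronglyMeasurable).2 hsq).abs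
  -- Nonnegativity of this variance is the Cauchy-Schwarz step from the second moment to the first.
  have hvar := variance_nonneg (fun ω => |∑ i ∈ Finset.range N,
      (projIncrement B a (gridPair h b i) ω ^ 2 - (∑ k, a k ^ 2) * (h : ℝ) ^ (2 * H))|) P
  rw [variance_eq_sub hL] at hvar
  simp only [Pi.pow_apply, sq_abs] at hvar
  refine ⟨hint.abs, (le_abs_self _).trans (abs_le_of_sq_le_sq ?_ (by positivity))⟩
  linarith [hB.integral_sq_sum_gridPair_le hH a h b N hN]

end IsFractionalBrownianMotion

/-! ### Almost sure rates -/

/-- Markov's inequality gives summable probabilities, of order `2^{-n(q - q')}`, and Borel-Cantelli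
applies. -/
theorem ae_eventually_le_of_integral_le {Ω : Type*} [MeasurableSpace Ω] {P : Measure Ω}
    [IsProbabilityMeasure P] {f : ℕ → Ω → ℝ} (h0 : ∀ n ω, 0 ≤ f n ω)
    (hi : ∀ n, Integrable (f n) P) {C q q' : ℝ}
    (hE : ∀ n : ℕ, ∫ ω, f n ω ∂P ≤ C * 2 ^ (-(n * q))) (hq : q' < q) :
    ∀ᵐ ω ∂P, ∀ᶠ n : ℕ in atTop, f n ω ≤ 2 ^ (-(n * q')) := by
  have hs : ∑' n : ℕ, P {ω | (2 : ℝ) ^ (-(n * q')) ≤ f n ω} ≠ ∞ := by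
    have hsum : Summable fun n : ℕ => C * ((2 : ℝ) ^ (-(q - q'))) ^ n :=
      (summable_geometric_of_lt_one (by positivity)
        (Real.rpow_lt_one_of_one_lt_of_neg (by norm_num) (by linarith))).mul_left C
    refine ne_top_of_le_ne_top hsum.tsum_ofReal_ne_top (ENNReal.tsum_le_tsum fun n => ?_)
    rw [← ofReal_measureReal]
    refine ENNReal.ofReal_le_ofReal ?_
    have h1 := (mul_meas_ge_le_integral_of_nonneg (Eventually.of_forall (h0 n)) (hi n)
      ((2 : ℝ) ^ (-(n * q')))).trans (hE n)
    have h2 : (0 : ℝ) < 2 ^ (-(n * q')) := by positivity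
    refine le_of_mul_le_mul_left (h1.trans (le_of_eq ?_)) h2
    rw [← Real.rpow_natCast, ← Real.rpow_mul (by norm_num), mul_left_comm,
      ← Real.rpow_add (by norm_num)]
    congr 2
    ring
  filter_upwards [ae_eventually_notMem hs] with ω hω
  filter_upwards [hω] with n hn
  exact (not_le.1 hn).le

theorem one_sub_max_half (H : ℝ) : 1 - max (1 / 2) H = min (1 / 2) (1 - H) := by
  rcases le_total (1 / 2) H with h | h
  · rw [max_eq_right h, min_eq_right (by linarith)]
  · rw [max_eq_left h, min_eq_left (by linarith)]; norm_num

/-- The sum over the dyadic blocks of level `m` of the absolute values of the sums of `ξ` over the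
dyadic intervals of level `n` in the block. -/
noncomputable def blockSum (n m : ℕ) (ξ : ℕ → ℝ) : ℝ :=
  ∑ b ∈ Finset.range (2 ^ m), |∑ i ∈ Finset.range (2 ^ (n - m)), ξ (b * 2 ^ (n - m) + i)|

namespace IsFractionalBrownianMotion

variable {Ω : Type*} [MeasurableSpace Ω] {P : Measure Ω} {K : ℕ} {H : ℝ}
  {B : ℝ → Ω → EuclideanSpace ℝ (Fin K)}

/-- With `m = ⌊μn⌋`, the mean is at most a constant times `h · 2^m · 2^{(n-m)(1-μ)}`, of order
`2^{-(n-m)μ}`, and `n - m ≥ (1 - μ)n`. -/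
theorem ae_blockSum_projIncrement_le (hB : IsFractionalBrownianMotion H B P) (hH : 0 < H)
    (hH1 : H < 1) {T : ℝ≥0} (hT : 0 < T) (a : Fin K → ℝ) {μ : ℝ} (hμ : μ = min (1 / 2) (1 - H))
    {q : ℝ} (hq : q < (1 - μ) * μ) :
    ∀ᵐ ω ∂P, ∀ᶠ n : ℕ in atTop, blockSum n ⌊μ * n⌋₊ (fun i =>
      ((T / 2 ^ n : ℝ≥0) : ℝ) ^ (1 - 2 * H) * (projIncrement B a (gridPair (T / 2 ^ n) 0 i) ω ^ 2
        - (∑ k, a k ^ 2) * ((T / 2 ^ n : ℝ≥0) : ℝ) ^ (2 * H))) ≤ 2 ^ (-(n * q)) := by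
  have hprob := hB.gaussian.isProbabilityMeasure
  have hA : 0 ≤ ∑ k, a k ^ 2 := Finset.sum_nonneg fun k _ => sq_nonneg _
  have hμ0 : 0 < μ := by rw [hμ]; exact lt_min (by norm_num) (by linarith)
  have hμ1 : μ ≤ 1 / 2 := by rw [hμ]; exact min_le_left _ _
  have hblock : ∀ (n : ℕ) ω, blockSum n ⌊μ * n⌋₊ (fun i =>
      ((T / 2 ^ n : ℝ≥0) : ℝ) ^ (1 - 2 * H) * (projIncrement B a (gridPair (T / 2 ^ n) 0 i) ω ^ 2
        - (∑ k, a k ^ 2) * ((T / 2 ^ n : ℝ≥0) : ℝ) ^ (2 * H)))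
      = ((T / 2 ^ n : ℝ≥0) : ℝ) ^ (1 - 2 * H) * ∑ b ∈ Finset.range (2 ^ ⌊μ * n⌋₊),
        |∑ i ∈ Finset.range (2 ^ (n - ⌊μ * n⌋₊)),
          (projIncrement B a (gridPair (T / 2 ^ n) (b * 2 ^ (n - ⌊μ * n⌋₊)) i) ω ^ 2
            - (∑ k, a k ^ 2) * ((T / 2 ^ n : ℝ≥0) : ℝ) ^ (2 * H))| := by
    intro n ω
    rw [blockSum, Finset.mul_sum]
    refine Finset.sum_congr rfl fun b _ => ?_
    rw [← Finset.mul_sum, abs_mul, abs_of_nonneg (by positivity)]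
    simp only [gridPair, zero_add]
  simp only [hblock]
  refine ae_eventually_le_of_integral_le (C := 3 * (∑ k, a k ^ 2) * T) (q := (1 - μ) * μ)
    (fun n ω => mul_nonneg (by positivity) (Finset.sum_nonneg fun b _ => abs_nonneg _)) (fun n => ?_) (fun n => ?_) hq
  · exact (integrable_finsetSum _ fun b _ =>
      (hB.integral_abs_sum_gridPair_le hH a _ _ _ Nat.one_le_two_pow).1).const_mul _
  · rw [integral_const_mul, integral_finsetSum _ fun b _ =>
      (hB.integral_abs_sum_gridPair_le hH a _ _ _ Nat.one_le_two_pow).1]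
    set m := ⌊μ * n⌋₊ with hm
    have hmn : (m : ℝ) ≤ μ * n := Nat.floor_le (by positivity)
    have hmn' : m ≤ n := by
      have : (m : ℝ) ≤ n := hmn.trans (by nlinarith [(Nat.cast_nonneg n : (0 : ℝ) ≤ n)])
      exact_mod_cast this
    set h : ℝ≥0 := T / 2 ^ n with hh
    have hh0 : 0 < (h : ℝ) := by
      have : 0 < h := by positivity
      exact_mod_cast this
    have hhr : (h : ℝ) = T * 2 ^ (-(n : ℝ)) := by
      rw [hh, Real.rpow_neg (by norm_num), Real.rpow_natCast]; push_cast; rfl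
    calc _ ≤ (h : ℝ) ^ (1 - 2 * H) * ∑ b ∈ Finset.range (2 ^ m),
          3 * ((∑ k, a k ^ 2) * (h : ℝ) ^ (2 * H)) * ((2 ^ (n - m) : ℕ) : ℝ) ^ max (1 / 2) H := by
          refine mul_le_mul_of_nonneg_left (Finset.sum_le_sum fun b _ => ?_) (by positivity)
          exact (hB.integral_abs_sum_gridPair_le hH a _ _ _ Nat.one_le_two_pow).2
      _ = 3 * (∑ k, a k ^ 2) * (h ^ (1 - 2 * H) * (h : ℝ) ^ (2 * H)) * ((2 : ℝ) ^ (m : ℝ)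
          * ((2 : ℝ) ^ ((n : ℝ) - m)) ^ max (1 / 2) H) := by
          rw [Finset.sum_const, Finset.card_range, nsmul_eq_mul]
          push_cast
          rw [← Nat.cast_sub hmn', Real.rpow_natCast, Real.rpow_natCast]
          ring
      _ = 3 * (∑ k, a k ^ 2) * T * 2 ^ (-(((n : ℝ) - m) * μ)) := by
          rw [← Real.rpow_add hh0, sub_add_cancel, Real.rpow_one, hhr,
            ← Real.rpow_mul (by norm_num), ← Real.rpow_add (by norm_num)]
          have : (2 : ℝ) ^ (-(((n : ℝ) - m) * μ)) = 2 ^ (-(n : ℝ))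
              * 2 ^ ((m : ℝ) + ((n : ℝ) - m) * max (1 / 2) H) := by
            rw [← Real.rpow_add (by norm_num), hμ, ← one_sub_max_half]
            congr 1; ring
          rw [this]; ring
      _ ≤ _ := by
          refine mul_le_mul_of_nonneg_left ?_ (by positivity)
          refine Real.rpow_le_rpow_of_exponent_le (by norm_num) ?_
          nlinarith

end IsFractionalBrownianMotion

/-! ### Products of coordinates by polarisation, and size of single increments -/

theorem blockSum_half_sub_le (n m : ℕ) (f g h : ℕ → ℝ) :
    blockSum n m (fun i => (f i - g i - h i) / 2)
      ≤ (blockSum n m f + blockSum n m g + blockSum n m h) / 2 := by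
  simp only [blockSum]
  rw [← Finset.sum_add_distrib, ← Finset.sum_add_distrib, Finset.sum_div]
  refine Finset.sum_le_sum fun b _ => ?_
  rw [← Finset.sum_div, Finset.sum_sub_distrib, Finset.sum_sub_distrib, abs_div,
    abs_of_pos (zero_lt_two (α := ℝ))]
  gcongr
  exact (abs_sub _ _).trans (add_le_add_left (abs_sub _ _) _)

theorem coe_gridPair_zero {T : ℝ} (hT : 0 ≤ T) (n i : ℕ) :
    ((gridPair (T.toNNReal / 2 ^ n) 0 i).1 : ℝ) = dyadicPoint T n i ∧
    ((gridPair (T.toNNReal / 2 ^ n) 0 i).2 : ℝ) = dyadicPoint T n (i + 1) := by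
  simp only [gridPair, dyadicPoint, zero_add]
  push_cast
  rw [Real.coe_toNNReal T hT]
  constructor <;> ring

/-- The increment of `x` over the `i`-th dyadic interval of level `n`. -/
noncomputable def dyadicIncrement (T : ℝ) (n : ℕ) (x : ℝ → ℝ) (i : ℕ) : ℝ :=
  x (dyadicPoint T n (i + 1)) - x (dyadicPoint T n i)

namespace IsFractionalBrownianMotion

variable {Ω : Type*} [MeasurableSpace Ω] {P : Measure Ω} {K : ℕ} {H : ℝ}
  {B : ℝ → Ω → EuclideanSpace ℝ (Fin K)}

/-- Polarisation `ab = ((a + b)² - a² - b²) / 2` in the directions `e_k + e_l`, `e_k`, `e_l`. It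
needs no independence of the coordinates and covers `k = l` as well. -/
theorem ae_blockSum_le (hB : IsFractionalBrownianMotion H B P) (hH : 0 < H)
    (hH1 : H < 1) {T : ℝ} (hT : 0 < T) {μ : ℝ} (hμ : μ = min (1 / 2) (1 - H))
    {q : ℝ} (hq : q < (1 - μ) * μ) :
    ∀ᵐ ω ∂P, ∀ᶠ n : ℕ in atTop, ∀ k l : Fin K, blockSum n ⌊μ * n⌋₊ (fun i =>
      (T / 2 ^ n) ^ (1 - 2 * H) * (dyadicIncrement T n (fun t => B t ω k) i
        * dyadicIncrement T n (fun t => B t ω l) i - if k = l then (T / 2 ^ n) ^ (2 * H) else 0))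
      ≤ 2 * 2 ^ (-(n * q)) := by
  have hT' : 0 < T.toNNReal := by simpa using hT
  have h1 := fun k => hB.ae_blockSum_projIncrement_le hH hH1 hT' (Pi.single k 1) hμ hq
  have h2 := fun k l => hB.ae_blockSum_projIncrement_le hH hH1 hT'
    (Pi.single k 1 + Pi.single l 1) hμ hq
  filter_upwards [ae_all_iff.2 h1, ae_all_iff.2 fun k => ae_all_iff.2 (h2 k)] with ω g1 g2
  filter_upwards [eventually_all.2 g1, eventually_all.2 fun k => eventually_all.2 (g2 k)]
    with n f1 f2 k l
  have hcoe : ((T.toNNReal / 2 ^ n : ℝ≥0) : ℝ) = T / 2 ^ n := by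
    push_cast; rw [Real.coe_toNNReal T hT.le]
  have e1 : ∀ k i, projIncrement B (Pi.single k 1) (gridPair (T.toNNReal / 2 ^ n) 0 i) ω
      = dyadicIncrement T n (fun t => B t ω k) i := by
    intro k i
    simp [projIncrement, dyadicIncrement, coe_gridPair_zero hT.le, Pi.single_apply]
  have e2 : ∀ i, projIncrement B (Pi.single k 1 + Pi.single l 1)
        (gridPair (T.toNNReal / 2 ^ n) 0 i) ω
      = dyadicIncrement T n (fun t => B t ω k) i + dyadicIncrement T n (fun t => B t ω l) i := by
    intro i
    simp [projIncrement, dyadicIncrement, coe_gridPair_zero hT.le, Pi.single_apply, add_mul,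
      Finset.sum_add_distrib]
  have s1 : ∀ k : Fin K, ∑ j, (Pi.single k 1 : Fin K → ℝ) j ^ 2 = 1 := by
    intro k; simp [Pi.single_apply]
  have s2 : ∑ j, (Pi.single k 1 + Pi.single l 1 : Fin K → ℝ) j ^ 2
      = 2 + 2 * (if k = l then 1 else 0) := by
    have : ∀ j, (Pi.single k 1 + Pi.single l 1 : Fin K → ℝ) j ^ 2
        = (if j = k then 1 else 0) + (if j = l then 1 else 0)
          + 2 * (if j = k then (if k = l then 1 else 0) else 0) := by
      intro j
      simp only [Pi.add_apply, Pi.single_apply]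
      by_cases hk : j = k
      · subst hk
        by_cases hl : j = l
        · subst hl; simp; norm_num
        · simp [hl]
      · by_cases hl : j = l
        · subst hl; simp [hk]
        · simp [hk, hl]
    simp_rw [this, Finset.sum_add_distrib, ← Finset.mul_sum]
    simp; norm_num
  have a1 := f1 k
  have a2 := f1 l
  have a3 := f2 k l
  simp only [e1, e2, s1, s2, hcoe] at a1 a2 a3
  have := blockSum_half_sub_le n ⌊μ * n⌋₊ _ _ _ |>.trans
    (div_le_div_of_nonneg_right (add_le_add (add_le_add a3 a1) a2) zero_le_two)
  refine (le_of_eq ?_).trans (this.trans ?_)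
  · congr 1
    ext i
    split_ifs <;> ring
  -- Polarisation yields the constant `3/2`, rounded up to `2`.
  · have : (0 : ℝ) < 2 ^ (-(n * q)) := by positivity
    linarith

/-- Kolmogorov's argument: the `2^n` moments of order `2p` add up to a multiple of `2^{-n(2Hp -
1)}`, which beats `2^{-2npβ}` as soon as `p(H - β) ≥ 1`. -/
theorem ae_dyadicIncrement_le (hB : IsFractionalBrownianMotion H B P) (hH : 0 < H)
    {T : ℝ} (hT : 0 < T) {β : ℝ} (hβ : β < H) :
    ∀ᵐ ω ∂P, ∀ᶠ n : ℕ in atTop, ∀ k : Fin K, ∀ i < 2 ^ n,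
      |dyadicIncrement T n (fun t => B t ω k) i| ≤ 2 ^ (-(n * β)) := by
  have hprob := hB.gaussian.isProbabilityMeasure
  have hT' : 0 < T.toNNReal := by simpa using hT
  obtain ⟨p, hp⟩ := exists_nat_ge (1 / (H - β))
  have hp1 : 1 ≤ p * (H - β) := by rwa [div_le_iff₀ (by linarith)] at hp
  have hp0 : p ≠ 0 := by rintro rfl; norm_num at hp1
  have hp0' : (0 : ℝ) < p := by positivity
  have hG := fun (k : Fin K) n i => (hB.isGaussianProcess_projIncrement
    (Pi.single k 1)).hasGaussianLaw_eval (gridPair (T.toNNReal / 2 ^ n) 0 i)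
  have e1 : ∀ n k i ω, projIncrement B (Pi.single k 1) (gridPair (T.toNNReal / 2 ^ n) 0 i) ω
      = dyadicIncrement T n (fun t => B t ω k) i := by
    intro n k i ω
    simp [projIncrement, dyadicIncrement, coe_gridPair_zero hT.le, Pi.single_apply]
  have hint : ∀ n k i, Integrable
      (fun ω => dyadicIncrement T n (fun t => B t ω k) i ^ (2 * p)) P := by
    intro n k i
    simp_rw [← e1]
    exact (hG k n i).integrable_pow _
  have hE : ∀ n k i, ∫ ω, dyadicIncrement T n (fun t => B t ω k) i ^ (2 * p) ∂P
      = ((T / 2 ^ n) ^ (2 * H)) ^ p * ∫ x : ℝ, x ^ (2 * p) ∂(gaussianReal 0 1) := by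
    intro n k i
    simp_rw [← e1]
    have hcoe : ((T.toNNReal / 2 ^ n : ℝ≥0) : ℝ) = T / 2 ^ n := by
      push_cast; rw [Real.coe_toNNReal T hT.le]
    have s1 : ∑ j, (Pi.single k 1 : Fin K → ℝ) j ^ 2 = 1 := by simp [Pi.single_apply]
    rw [(hG k n i).integral_pow (hB.integral_projIncrement _ _),
      hB.integral_sq_gridPair hH, s1, one_mul, hcoe, pow_mul, Real.sq_sqrt (by positivity)]
  have hc : 0 ≤ ∫ x : ℝ, x ^ (2 * p) ∂(gaussianReal 0 1) :=
    integral_nonneg fun x => by simp only [pow_mul]; positivity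
  have main := ae_eventually_le_of_integral_le (P := P)
    (f := fun n ω => ∑ i ∈ Finset.range (2 ^ n), ∑ k : Fin K,
      dyadicIncrement T n (fun t => B t ω k) i ^ (2 * p))
    (C := K * T ^ (2 * H * p) * ∫ x : ℝ, x ^ (2 * p) ∂(gaussianReal 0 1))
    (q := 2 * H * p - 1) (q' := 2 * p * β)
    (fun n ω => Finset.sum_nonneg fun i _ => Finset.sum_nonneg fun k _ => by
      rw [pow_mul]; positivity)
    (fun n => integrable_finsetSum _ fun i _ => integrable_finsetSum _ fun k _ => hint n k i)
    (fun n => ?_) (by nlinarith)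
  · filter_upwards [main] with ω hω
    filter_upwards [hω] with n hn k i hi
    have h1 : dyadicIncrement T n (fun t => B t ω k) i ^ (2 * p) ≤ 2 ^ (-(n * (2 * p * β))) := by
      refine le_trans ?_ hn
      refine le_trans ?_ (Finset.single_le_sum (f := fun i => ∑ k : Fin K,
        dyadicIncrement T n (fun t => B t ω k) i ^ (2 * p)) (fun i _ =>
          Finset.sum_nonneg fun k _ => by rw [pow_mul]; positivity) (Finset.mem_range.2 hi))
      exact Finset.single_le_sum (f := fun k => dyadicIncrement T n (fun t => B t ω k) i ^ (2 * p))
        (fun k _ => by rw [pow_mul]; positivity) (Finset.mem_univ k)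
    refine le_of_pow_le_pow_left₀ (n := 2 * p) (by omega) (by positivity) ?_
    rw [pow_mul, sq_abs, ← pow_mul]
    refine h1.trans (le_of_eq ?_)
    rw [← Real.rpow_mul_natCast (by norm_num)]
    congr 1; push_cast; ring
  · rw [integral_finsetSum _ fun i _ => integrable_finsetSum _ fun k _ => hint n k i]
    rw [Finset.sum_congr rfl fun i _ => integral_finsetSum _ fun k _ => hint n k i]
    rw [Finset.sum_congr rfl fun i _ => Finset.sum_congr rfl fun k _ => hE n k i]
    simp only [Finset.sum_const, Finset.card_range, Finset.card_univ, Fintype.card_fin,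
      nsmul_eq_mul]
    refine le_of_eq ?_
    have : ((T / 2 ^ n) ^ (2 * H)) ^ p = T ^ (2 * H * p) * 2 ^ (-(n * (2 * H * p))) := by
      rw [← Real.rpow_mul_natCast (by positivity), Real.div_rpow hT.le (by positivity),
        ← Real.rpow_natCast 2 n, ← Real.rpow_mul (by norm_num), Real.rpow_neg (by norm_num)]
      rfl
    have h2 : (2 : ℝ) ^ (-(n * (2 * H * p - 1))) = 2 ^ n * 2 ^ (-(n * (2 * H * p))) := by
      rw [← Real.rpow_natCast 2 n, ← Real.rpow_add (by norm_num)]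
      congr 1; ring
    rw [this, h2]; push_cast; ring

end IsFractionalBrownianMotion

/-! ### Hölder continuity from dyadic increments -/

theorem dyadicPoint_succ_two_mul (T : ℝ) (n i : ℕ) :
    dyadicPoint T (n + 1) (2 * i) = dyadicPoint T n i := by
  simp only [dyadicPoint]; push_cast; rw [pow_succ]; field_simp

/-- Chaining: each time is the limit of its left dyadic neighbours, with geometrically decreasing
errors, and two times are compared at the level matching their distance. -/
theorem exists_holder_of_dyadicIncrement {T : ℝ} (hT : 0 < T) {x : ℝ → ℝ}
    (hx : ContinuousOn x (Icc 0 T)) {β : ℝ} (hβ : 0 < β)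
    (h : ∀ᶠ n : ℕ in atTop, ∀ i < 2 ^ n, |dyadicIncrement T n x i| ≤ 2 ^ (-(n * β))) :
    ∃ C, 0 ≤ C ∧ ∀ s t, 0 ≤ s → s ≤ t → t ≤ T → |x t - x s| ≤ C * (t - s) ^ β := by
  set r : ℝ := 2 ^ (-β) with hr
  have hr0 : 0 < r := by positivity
  have hr1 : r < 1 := Real.rpow_lt_one_of_one_lt_of_neg (by norm_num) (by linarith)
  have hrn : ∀ n : ℕ, (2 : ℝ) ^ (-(n * β)) = r ^ n := fun n => by
    rw [hr, ← Real.rpow_mul_natCast (by norm_num)]; congr 1; ring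
  -- The finitely many exceptional levels are absorbed by adding all their ratios to the constant.
  obtain ⟨C, hC0, hC⟩ : ∃ C, 0 ≤ C ∧ ∀ n, ∀ i < 2 ^ n, |dyadicIncrement T n x i| ≤ C * r ^ n := by
    obtain ⟨N, hN⟩ := eventually_atTop.1 h
    have h0 : 0 ≤ ∑ n ∈ Finset.range N, ∑ i ∈ Finset.range (2 ^ n),
        |dyadicIncrement T n x i| / r ^ n :=
      Finset.sum_nonneg fun n _ => Finset.sum_nonneg fun i _ => by positivity
    refine ⟨1 + ∑ n ∈ Finset.range N, ∑ i ∈ Finset.range (2 ^ n),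
      |dyadicIncrement T n x i| / r ^ n, by positivity, fun n i hi => ?_⟩
    rcases le_or_gt N n with hn | hn
    · refine (hN n hn i hi).trans ?_
      rw [hrn]
      exact le_mul_of_one_le_left (by positivity) (by linarith)
    · rw [← div_le_iff₀ (by positivity)]
      have h1 := Finset.single_le_sum (f := fun n => ∑ i ∈ Finset.range (2 ^ n),
        |dyadicIncrement T n x i| / r ^ n) (fun n _ => Finset.sum_nonneg fun i _ => by positivity)
        (Finset.mem_range.2 hn)
      have h2 := Finset.single_le_sum (f := fun i => |dyadicIncrement T n x i| / r ^ n)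
        (fun i _ => by positivity) (Finset.mem_range.2 hi)
      linarith [h2.trans h1]
  have hfl : ∀ s : ℝ, 0 ≤ s → ∀ n : ℕ,
      dyadicPoint T n ⌊s * 2 ^ n / T⌋₊ ≤ s ∧ s < dyadicPoint T n (⌊s * 2 ^ n / T⌋₊ + 1) := by
    intro s hs n
    have h1 : (⌊s * 2 ^ n / T⌋₊ : ℝ) ≤ s * 2 ^ n / T := Nat.floor_le (by positivity)
    have h2 : s * 2 ^ n / T < ⌊s * 2 ^ n / T⌋₊ + 1 := Nat.lt_floor_add_one _
    simp only [dyadicPoint]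
    rw [div_le_iff₀ (by positivity), lt_div_iff₀ (by positivity)]
    rw [le_div_iff₀ hT] at h1
    rw [div_lt_iff₀ hT] at h2
    push_cast
    exact ⟨h1, h2⟩
  have hflT : ∀ s : ℝ, s ≤ T → ∀ n : ℕ, ⌊s * 2 ^ n / T⌋₊ ≤ 2 ^ n := by
    intro s hs n
    have : s * 2 ^ n / T ≤ ((2 ^ n : ℕ) : ℝ) := by
      rw [div_le_iff₀ hT]; push_cast
      nlinarith [(by positivity : (0 : ℝ) < 2 ^ n)]
    exact Nat.floor_le_of_le this
  have hapx : ∀ s, 0 ≤ s → s ≤ T → ∀ n : ℕ,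
      |x (dyadicPoint T n ⌊s * 2 ^ n / T⌋₊) - x s| ≤ C * r ^ n / (1 - r) := by
    intro s hs hsT n
    refine dist_le_of_le_geometric_of_tendsto r C hr1 (fun n => ?_)
      (f := fun n : ℕ => x (dyadicPoint T n ⌊s * 2 ^ n / T⌋₊)) ?_ n
    · set i := ⌊s * 2 ^ n / T⌋₊ with hi
      set j := ⌊s * 2 ^ (n + 1) / T⌋₊ with hj
      -- Successive left neighbours coincide when `j` is even and differ by one increment of level
      -- `n + 1` when `j` is odd.
      have hj2 : i = j / 2 := by
        rw [hi, hj, ← Nat.floor_div_natCast]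
        congr 1
        rw [pow_succ]; push_cast; ring
      have hjT : j ≤ 2 ^ (n + 1) := hflT s hsT _
      rcases Nat.even_or_odd' j with ⟨c, hc | hc⟩
      · have hic : i = c := by omega
        rw [hc, hic, dyadicPoint_succ_two_mul, dist_self]
        positivity
      · have hic : i = c := by omega
        rw [hc, hic, ← dyadicPoint_succ_two_mul, dist_comm, Real.dist_eq]
        refine (hC (n + 1) (2 * c) (by omega)).trans ?_
        refine mul_le_mul_of_nonneg_left ?_ hC0
        exact pow_le_pow_of_le_one hr0.le hr1.le (Nat.le_succ n)
    · refine (hx s ⟨hs, hsT⟩).tendsto.comp (tendsto_nhdsWithin_iff.2 ⟨?_, ?_⟩)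
      · have hz : Tendsto (fun n : ℕ => s - T / 2 ^ n) atTop (nhds s) := by
          have := (tendsto_pow_atTop_nhds_zero_of_lt_one (by norm_num : (0 : ℝ) ≤ 1 / 2)
            (by norm_num)).const_mul T
          simpa [div_eq_mul_inv] using tendsto_const_nhds.sub this
        refine tendsto_of_tendsto_of_tendsto_of_le_of_le hz tendsto_const_nhds
          (fun n => ?_) (fun n => (hfl s hs n).1)
        have := (hfl s hs n).2
        have e : dyadicPoint T n (⌊s * 2 ^ n / T⌋₊ + 1)
            = dyadicPoint T n ⌊s * 2 ^ n / T⌋₊ + T / 2 ^ n := by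
          simp only [dyadicPoint]; push_cast; ring
        simp only
        linarith
      · filter_upwards with n
        refine ⟨?_, (hfl s hs n).1.trans hsT⟩
        simp only [dyadicPoint]; positivity
  refine ⟨(2 * (C / (1 - r)) + C) * (2 / T) ^ β, by
    have : 0 ≤ C / (1 - r) := div_nonneg hC0 (by linarith)
    positivity, fun s t hs hst htT => ?_⟩
  have hD : 0 ≤ C / (1 - r) := div_nonneg hC0 (by linarith)
  rcases hst.eq_or_lt with rfl | hlt
  · rw [sub_self, sub_self, abs_zero]; positivity
  -- The level with `2^{-(n+1)} < (t - s) / T ≤ 2^{-n}`: the upper bound makes the left neighbours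
  -- equal or adjacent, the lower one produces the factor `(2 / T) ^ β`.
  obtain ⟨n, hn1, hn2⟩ := exists_nat_pow_near_of_lt_one (x := (t - s) / T) (y := 1 / 2)
    (div_pos (by linarith) hT) (by rw [div_le_one hT]; linarith) (by norm_num) (by norm_num)
  have hrn' : r ^ n ≤ (2 / T) ^ β * (t - s) ^ β := by
    rw [← Real.mul_rpow (by positivity) (by linarith), ← hrn]
    have : (2 : ℝ) ^ (-(n * β)) = ((1 / 2) ^ n) ^ β := by
      rw [one_div, inv_pow, ← Real.rpow_natCast, ← Real.rpow_neg (by norm_num),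
        ← Real.rpow_mul (by norm_num)]
      congr 1; ring
    rw [this]
    refine Real.rpow_le_rpow (by positivity) ?_ hβ.le
    rw [pow_succ] at hn1
    have e : 2 / T * (t - s) = 2 * ((t - s) / T) := by ring
    rw [e]; linarith
  have hmid : |x (dyadicPoint T n ⌊t * 2 ^ n / T⌋₊) - x (dyadicPoint T n ⌊s * 2 ^ n / T⌋₊)|
      ≤ C * r ^ n := by
    have h1 : ⌊s * 2 ^ n / T⌋₊ ≤ ⌊t * 2 ^ n / T⌋₊ := Nat.floor_le_floor (by gcongr)
    have h2 : ⌊t * 2 ^ n / T⌋₊ ≤ ⌊s * 2 ^ n / T⌋₊ + 1 := by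
      rw [← Nat.floor_add_one (by positivity)]
      refine Nat.floor_le_floor ?_
      rw [one_div, inv_pow, div_le_iff₀ hT, inv_mul_eq_div, le_div_iff₀ (by positivity)] at hn2
      have : (t * 2 ^ n - s * 2 ^ n) / T ≤ 1 := by rw [div_le_one hT]; linarith
      rw [sub_div] at this
      linarith
    rcases (by omega : ⌊t * 2 ^ n / T⌋₊ = ⌊s * 2 ^ n / T⌋₊ ∨
      ⌊t * 2 ^ n / T⌋₊ = ⌊s * 2 ^ n / T⌋₊ + 1) with h3 | h3
    · rw [h3, sub_self, abs_zero]; positivity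
    · rw [h3]
      refine hC n _ ?_
      have := hflT t htT n
      omega
  have ht := hapx t (by linarith) htT n
  have hs' := hapx s hs (by linarith) n
  rw [abs_sub_comm] at ht
  have e : C * r ^ n / (1 - r) = C / (1 - r) * r ^ n := by ring
  rw [e] at ht hs'
  calc |x t - x s| ≤ (2 * (C / (1 - r)) + C) * r ^ n := by
        have := abs_le.1 ht; have := abs_le.1 hs'; have := abs_le.1 hmid
        rw [abs_le]; constructor <;> linarith
    _ ≤ _ := by
        rw [mul_assoc]
        exact mul_le_mul_of_nonneg_left hrn' (by positivity)

/-! ### Scaled quadratic variations of controlled paths -/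

/-- The weight is frozen at the left end of each block. The three terms are the frozen sums, the
oscillation of the weight, and the incomplete last block. Allowing every `J` makes the later
estimates uniform in `t`. -/
theorem abs_sum_mul_le_blockSum {n m : ℕ} (hm : m ≤ n) {G ξ : ℕ → ℝ} {M D X : ℝ}
    (hM : 0 ≤ M) (hD0 : 0 ≤ D) (hX0 : 0 ≤ X) (hG : ∀ i < 2 ^ n, |G i| ≤ M)
    (hD : ∀ b < 2 ^ m, ∀ i < 2 ^ (n - m),
      |G (b * 2 ^ (n - m) + i) - G (b * 2 ^ (n - m))| ≤ D)
    (hX : ∀ i < 2 ^ n, |ξ i| ≤ X) {J : ℕ} (hJ : J ≤ 2 ^ n) :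
    |∑ i ∈ Finset.range J, G i * ξ i|
      ≤ M * blockSum n m ξ + 2 ^ n * (D * X) + 2 ^ (n - m) * (M * X) := by
  set N := 2 ^ (n - m) with hN
  have hN0 : 0 < N := by positivity
  have hmN : 2 ^ m * N = 2 ^ n := by rw [hN, ← pow_add]; congr 1; omega
  have hlt : ∀ b < 2 ^ m, ∀ i < N, b * N + i < 2 ^ n := by
    intro b hb i hi
    calc b * N + i < (b + 1) * N := by rw [add_mul, one_mul]; omega
      _ ≤ 2 ^ m * N := Nat.mul_le_mul_right _ hb
      _ = 2 ^ n := hmN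
  have hblock : ∀ b < 2 ^ m, |∑ i ∈ Finset.range N, G (b * N + i) * ξ (b * N + i)|
      ≤ M * |∑ i ∈ Finset.range N, ξ (b * N + i)| + N * (D * X) := by
    intro b hb
    have e : ∑ i ∈ Finset.range N, G (b * N + i) * ξ (b * N + i)
        = G (b * N) * ∑ i ∈ Finset.range N, ξ (b * N + i)
          + ∑ i ∈ Finset.range N, (G (b * N + i) - G (b * N)) * ξ (b * N + i) := by
      rw [Finset.mul_sum, ← Finset.sum_add_distrib]
      exact Finset.sum_congr rfl fun i _ => by ring
    rw [e]
    refine (abs_add_le _ _).trans (add_le_add ?_ ?_)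
    · rw [abs_mul]
      exact mul_le_mul_of_nonneg_right (hG _ (by simpa using hlt b hb 0 hN0)) (abs_nonneg _)
    · refine (Finset.abs_sum_le_sum_abs _ _).trans ?_
      calc _ ≤ ∑ i ∈ Finset.range N, D * X := by
            refine Finset.sum_le_sum fun i hi => ?_
            rw [Finset.mem_range] at hi
            rw [abs_mul]
            exact mul_le_mul (hD b hb i hi) (hX _ (hlt b hb i hi)) (abs_nonneg _) hD0
        _ = _ := by simp
  have hfull : ∀ c ≤ 2 ^ m, |∑ i ∈ Finset.range (c * N), G i * ξ i|
      ≤ ∑ b ∈ Finset.range c, (M * |∑ i ∈ Finset.range N, ξ (b * N + i)| + N * (D * X)) := by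
    intro c
    induction c with
    | zero => simp
    | succ c ih =>
      intro hc
      rw [add_mul, one_mul, Finset.sum_range_add, Finset.sum_range_succ]
      exact (abs_add_le _ _).trans (add_le_add (ih (by omega)) (hblock c (by omega)))
  have hJdec : J = J / N * N + J % N := by rw [mul_comm]; exact (Nat.div_add_mod J N).symm
  have hq : J / N ≤ 2 ^ m := by
    refine Nat.div_le_of_le_mul ?_
    rw [mul_comm, hmN]; exact hJ
  rw [hJdec, Finset.sum_range_add]
  refine (abs_add_le _ _).trans (add_le_add ((hfull _ hq).trans ?_) ?_)
  · rw [Finset.sum_add_distrib, ← Finset.mul_sum]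
    refine add_le_add (mul_le_mul_of_nonneg_left ?_ hM) ?_
    · exact Finset.sum_le_sum_of_subset_of_nonneg (Finset.range_mono hq)
        fun _ _ _ => abs_nonneg _
    · rw [Finset.sum_const, Finset.card_range, nsmul_eq_mul, ← mul_assoc]
      refine mul_le_mul_of_nonneg_right ?_ (by positivity)
      have : J / N * N ≤ 2 ^ n := hmN ▸ Nat.mul_le_mul_right _ hq
      exact_mod_cast this
  · refine (Finset.abs_sum_le_sum_abs _ _).trans ?_
    calc _ ≤ ∑ i ∈ Finset.range (J % N), M * X := by
          refine Finset.sum_le_sum fun i hi => ?_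
          rw [Finset.mem_range] at hi
          have : J / N * N + i < 2 ^ n := by omega
          rw [abs_mul]
          exact mul_le_mul (hG _ this) (hX _ this) (abs_nonneg _) hM
      _ = (J % N : ℕ) * (M * X) := by simp
      _ ≤ 2 ^ (n - m) * (M * X) := by
          refine mul_le_mul_of_nonneg_right ?_ (by positivity)
          have : J % N ≤ 2 ^ (n - m) := (Nat.mod_lt _ hN0).le
          exact_mod_cast this

/-! ### The dyadic grid, Riemann sums and powers of the mesh -/

theorem dyadicPoint_succ_sub (T : ℝ) (n i : ℕ) :
    dyadicPoint T n (i + 1) - dyadicPoint T n i = T / 2 ^ n := by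
  simp only [dyadicPoint]; push_cast; ring

theorem dyadicPoint_mono {T : ℝ} (hT : 0 ≤ T) (n : ℕ) : Monotone (dyadicPoint T n) := by
  intro i j hij
  simp only [dyadicPoint]
  gcongr

theorem dyadicPoint_mem {T : ℝ} (hT : 0 ≤ T) {n i : ℕ} (hi : i ≤ 2 ^ n) :
    dyadicPoint T n i ∈ Icc 0 T := by
  refine ⟨by simp only [dyadicPoint]; positivity, ?_⟩
  have := dyadicPoint_mono hT n hi
  simpa [dyadicPoint] using this

/-- The number of dyadic intervals of level `n` contained in `[0, t]`. -/
noncomputable def dyadicIndex (T : ℝ) (n : ℕ) (t : ℝ) : ℕ := ⌊t * 2 ^ n / T⌋₊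

theorem dyadicIndex_le {T : ℝ} (hT : 0 < T) (n : ℕ) {t : ℝ} (ht : t ≤ T) :
    dyadicIndex T n t ≤ 2 ^ n := by
  refine Nat.floor_le_of_le ?_
  rw [div_le_iff₀ hT]; push_cast
  nlinarith [(by positivity : (0 : ℝ) < 2 ^ n)]

theorem dyadicPoint_dyadicIndex {T : ℝ} (hT : 0 < T) (n : ℕ) {t : ℝ} (ht : 0 ≤ t) :
    dyadicPoint T n (dyadicIndex T n t) ≤ t ∧
      t - dyadicPoint T n (dyadicIndex T n t) ≤ T / 2 ^ n := by
  rw [← dyadicPoint_succ_sub T n (dyadicIndex T n t)]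
  have h1 : (⌊t * 2 ^ n / T⌋₊ : ℝ) ≤ t * 2 ^ n / T := Nat.floor_le (by positivity)
  have h2 : t * 2 ^ n / T < ⌊t * 2 ^ n / T⌋₊ + 1 := Nat.lt_floor_add_one _
  rw [le_div_iff₀ hT] at h1
  rw [div_lt_iff₀ hT] at h2
  have e1 : dyadicPoint T n (dyadicIndex T n t) ≤ t := by
    simp only [dyadicPoint, dyadicIndex]
    rwa [div_le_iff₀ (by positivity)]
  have e2 : t ≤ dyadicPoint T n (dyadicIndex T n t + 1) := by
    simp only [dyadicPoint, dyadicIndex]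
    rw [le_div_iff₀ (by positivity)]; push_cast; exact h2.le
  exact ⟨e1, by linarith⟩

theorem scaledQV_eq {T : ℝ} (hT : 0 < T) (γ : ℝ) (n : ℕ) (x : ℝ → ℝ) {t : ℝ}
    (ht : t ∈ Icc 0 T) :
    scaledQV T γ n x t = ∑ i ∈ Finset.range (dyadicIndex T n t),
      (T / 2 ^ n) ^ γ * dyadicIncrement T n x i ^ 2 := by
  rw [scaledQV]
  have : (Finset.range (2 ^ n)).filter (fun i => dyadicPoint T n (i + 1) ≤ t)
      = Finset.range (dyadicIndex T n t) := by
    ext i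
    simp only [Finset.mem_filter, Finset.mem_range]
    have h0 : 0 ≤ t * 2 ^ n / T := by have := ht.1; positivity
    have : dyadicPoint T n (i + 1) ≤ t ↔ i < dyadicIndex T n t := by
      rw [dyadicIndex, ← Nat.succ_le_iff, Nat.le_floor_iff h0, dyadicPoint,
        div_le_iff₀ (by positivity), le_div_iff₀ hT, Nat.succ_eq_add_one]
    rw [this]
    have := dyadicIndex_le hT n ht.2
    constructor
    · exact fun h => h.2
    · exact fun h => ⟨by omega, h⟩
  rw [this]
  refine Finset.sum_congr rfl fun i _ => ?_
  rw [dyadicPoint_succ_sub, dyadicIncrement]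

/-- Hölder continuity bounds the error on each full interval; the term with `M` pays for the piece
between the last grid point and `t`. -/
theorem abs_riemannSum_sub_integral_le {T : ℝ} (hT : 0 < T) {G : ℝ → ℝ}
    (hc : ContinuousOn G (Icc 0 T)) {M L β : ℝ} (hM : ∀ t ∈ Icc 0 T, |G t| ≤ M) (hL0 : 0 ≤ L)
    (hβ : 0 ≤ β)
    (hL : ∀ s t, 0 ≤ s → s ≤ t → t ≤ T → |G t - G s| ≤ L * (t - s) ^ β) (n : ℕ) {t : ℝ}
    (ht : t ∈ Icc 0 T) :
    |∑ i ∈ Finset.range (dyadicIndex T n t), (T / 2 ^ n) * G (dyadicPoint T n i)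
        - ∫ r in (0 : ℝ)..t, G r| ≤ T * (L * (T / 2 ^ n) ^ β) + M * (T / 2 ^ n) := by
  set J := dyadicIndex T n t with hJ
  set h := T / 2 ^ n with hh
  have hh0 : 0 < h := by positivity
  have hJ2 : J ≤ 2 ^ n := dyadicIndex_le hT n ht.2
  obtain ⟨hJt, htJ⟩ := dyadicPoint_dyadicIndex hT n ht.1
  rw [← hJ] at hJt htJ
  have hint : ∀ a ∈ Icc 0 T, ∀ b ∈ Icc 0 T, IntervalIntegrable G volume a b := by
    intro a ha b hb
    refine (hc.mono ?_).intervalIntegrable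
    exact uIcc_subset_Icc ha hb
  have hmem : ∀ i ≤ J, dyadicPoint T n i ∈ Icc 0 T :=
    fun i hi => dyadicPoint_mem hT.le (hi.trans hJ2)
  have h0 : dyadicPoint T n 0 = 0 := by simp [dyadicPoint]
  have hsplit : ∫ r in (0 : ℝ)..t, G r
      = ∑ i ∈ Finset.range J, (∫ r in dyadicPoint T n i..dyadicPoint T n (i + 1), G r)
        + ∫ r in dyadicPoint T n J..t, G r := by
    rw [intervalIntegral.sum_integral_adjacent_intervals fun i hi =>
      hint _ (hmem i hi.le) _ (hmem (i + 1) hi), h0,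
      intervalIntegral.integral_add_adjacent_intervals]
    · exact hint _ ⟨le_rfl, hT.le⟩ _ (hmem J le_rfl)
    · exact hint _ (hmem J le_rfl) _ ht
  have hone : ∀ i ∈ Finset.range J, |h * G (dyadicPoint T n i)
      - ∫ r in dyadicPoint T n i..dyadicPoint T n (i + 1), G r| ≤ L * h ^ β * h := by
    intro i hi
    rw [Finset.mem_range] at hi
    have hle : dyadicPoint T n i ≤ dyadicPoint T n (i + 1) := dyadicPoint_mono hT.le n (by omega)
    have e : h * G (dyadicPoint T n i)
        - ∫ r in dyadicPoint T n i..dyadicPoint T n (i + 1), G r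
        = -∫ r in dyadicPoint T n i..dyadicPoint T n (i + 1), (G r - G (dyadicPoint T n i)) := by
      rw [intervalIntegral.integral_sub (hint _ (hmem i hi.le) _ (hmem (i + 1) hi))
        (by simp), intervalIntegral.integral_const, dyadicPoint_succ_sub, smul_eq_mul]
      ring
    rw [e, abs_neg]
    have := intervalIntegral.norm_integral_le_of_norm_le_const (C := L * h ^ β)
      (a := dyadicPoint T n i) (b := dyadicPoint T n (i + 1))
      (f := fun r => G r - G (dyadicPoint T n i)) ?_
    · rwa [dyadicPoint_succ_sub, abs_of_pos hh0] at this
    · intro r hr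
      rw [uIoc_of_le hle] at hr
      refine (hL _ _ (hmem i hi.le).1 hr.1.le (hr.2.trans (hmem (i + 1) hi).2)).trans ?_
      refine mul_le_mul_of_nonneg_left (Real.rpow_le_rpow (by linarith [hr.1]) ?_ hβ) hL0
      rw [hh, ← dyadicPoint_succ_sub T n i]
      linarith [hr.2]
  rw [hsplit, ← sub_sub, ← Finset.sum_sub_distrib]
  refine (abs_sub _ _).trans (add_le_add ?_ ?_)
  · refine (Finset.abs_sum_le_sum_abs _ _).trans ((Finset.sum_le_sum hone).trans ?_)
    rw [Finset.sum_const, Finset.card_range, nsmul_eq_mul]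
    have h1 : (J : ℝ) * h ≤ T := by
      have : (J : ℝ) ≤ 2 ^ n := by exact_mod_cast hJ2
      calc (J : ℝ) * h ≤ 2 ^ n * h := by gcongr
        _ = T := by rw [hh]; field_simp
    have h2 : 0 ≤ L * h ^ β := by positivity
    nlinarith
  · have := intervalIntegral.norm_integral_le_of_norm_le_const (C := M)
      (a := dyadicPoint T n J) (b := t) (f := G) ?_
    · refine this.trans (mul_le_mul_of_nonneg_left ?_ ((abs_nonneg _).trans (hM t ht)))
      rw [abs_of_nonneg (by linarith)]; exact htJ
    · intro r hr
      rw [uIoc_of_le hJt] at hr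
      exact hM r ⟨(hmem J le_rfl).1.trans hr.1.le, hr.2.trans ht.2⟩

theorem step_rpow {T : ℝ} (hT : 0 < T) (n : ℕ) (e : ℝ) :
    (T / 2 ^ n) ^ e = T ^ e * 2 ^ (-(n * e)) := by
  rw [Real.div_rpow hT.le (by positivity), ← Real.rpow_natCast 2 n,
    ← Real.rpow_mul (by norm_num), Real.rpow_neg (by norm_num)]
  rfl

theorem two_rpow_neg_mul_le {e r : ℝ} (h : r ≤ e) (n : ℕ) :
    (2 : ℝ) ^ (-(n * e)) ≤ 2 ^ (-(n * r)) :=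
  Real.rpow_le_rpow_of_exponent_le (by norm_num)
    (neg_le_neg (mul_le_mul_of_nonneg_left h (Nat.cast_nonneg n)))

theorem step_rpow_le {T : ℝ} (hT : 0 < T) (n : ℕ) {e r : ℝ} (h : r ≤ e) :
    (T / 2 ^ n) ^ e ≤ T ^ e * 2 ^ (-(n * r)) := by
  rw [step_rpow hT]
  exact mul_le_mul_of_nonneg_left (two_rpow_neg_mul_le h n) (by positivity)

/-- A block has duration at most `2T 2^{-nμ}`; the factor `2` is the price of the floor. -/
theorem two_pow_floor_sub {μ : ℝ} (hμ0 : 0 ≤ μ) (hμ1 : μ ≤ 1) (n : ℕ) :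
    ⌊μ * n⌋₊ ≤ n ∧ (2 : ℝ) ^ (n - ⌊μ * n⌋₊) ≤ 2 ^ n * (2 * 2 ^ (-(n * μ))) := by
  have h1 : (⌊μ * n⌋₊ : ℝ) ≤ μ * n := Nat.floor_le (by positivity)
  have h2 : μ * n < ⌊μ * n⌋₊ + 1 := Nat.lt_floor_add_one _
  have h3 : ⌊μ * n⌋₊ ≤ n := by
    have : (⌊μ * n⌋₊ : ℝ) ≤ n := h1.trans (by nlinarith [(Nat.cast_nonneg n : (0 : ℝ) ≤ n)])
    exact_mod_cast this
  refine ⟨h3, ?_⟩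
  rw [← Real.rpow_natCast, ← Real.rpow_natCast, Nat.cast_sub h3]
  have : (2 : ℝ) ^ (n : ℝ) * (2 * 2 ^ (-(n * μ))) = 2 ^ ((n : ℝ) + (1 + -(n * μ))) := by
    rw [Real.rpow_add (by norm_num), Real.rpow_add (by norm_num), Real.rpow_one]
  rw [this]
  exact Real.rpow_le_rpow_of_exponent_le (by norm_num) (by linarith)

/-- The normalised product of two increments, centred for fractional Brownian motion. -/
noncomputable def centredProduct {K : ℕ} (T H : ℝ) (n : ℕ) (z : Fin K → ℝ → ℝ) (k l : Fin K)
    (i : ℕ) : ℝ :=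
  (T / 2 ^ n) ^ (1 - 2 * H) * (dyadicIncrement T n (z k) i * dyadicIncrement T n (z l) i
    - if k = l then (T / 2 ^ n) ^ (2 * H) else 0)

/-- `x` is controlled by `z` on `[0, T]` with derivative `g`, all with constant `C`. -/
structure IsControlledWith {K : ℕ} (T β ρ C : ℝ) (z g : Fin K → ℝ → ℝ) (x : ℝ → ℝ) : Prop where
  nonneg : 0 ≤ C
  path : ∀ k s t, 0 ≤ s → s ≤ t → t ≤ T → |z k t - z k s| ≤ C * (t - s) ^ β
  deriv : ∀ k s t, 0 ≤ s → s ≤ t → t ≤ T → |g k t - g k s| ≤ C * (t - s) ^ β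
  bound : ∀ k, ∀ t ∈ Icc 0 T, |g k t| ≤ C
  cont : ∀ k, ContinuousOn (g k) (Icc 0 T)
  remainder : ∀ s t, 0 ≤ s → s ≤ t → t ≤ T →
    |x t - x s - ∑ k, g k s * (z k t - z k s)| ≤ C * (t - s) ^ ρ

namespace IsControlledWith

variable {K : ℕ} {T β ρ C : ℝ} {z g : Fin K → ℝ → ℝ} {x : ℝ → ℝ}

theorem abs_mul_sub_mul_le (h : IsControlledWith T β ρ C z g x) (k l : Fin K) {s t : ℝ}
    (hs : 0 ≤ s) (hst : s ≤ t) (ht : t ≤ T) :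
    |g k t * g l t - g k s * g l s| ≤ 2 * C ^ 2 * (t - s) ^ β := by
  have e : g k t * g l t - g k s * g l s
      = (g k t - g k s) * g l t + g k s * (g l t - g l s) := by ring
  have hC := h.nonneg
  have hp : 0 ≤ (t - s) ^ β := Real.rpow_nonneg (by linarith) _
  rw [e]
  refine (abs_add_le _ _).trans ?_
  rw [abs_mul, abs_mul]
  have h1 := mul_le_mul (h.deriv k s t hs hst ht) (h.bound l t ⟨hs.trans hst, ht⟩)
    (abs_nonneg _) (by positivity)
  have h2 := mul_le_mul (h.bound k s ⟨hs, hst.trans ht⟩) (h.deriv l s t hs hst ht)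
    (abs_nonneg _) (by positivity)
  linarith

theorem exists_abs_sum_centredProduct_le (h : IsControlledWith T β ρ C z g x) (hT : 0 < T)
    {H μ q r : ℝ} (hβ : 0 < β) (hβ1 : β ≤ 1) (hβH : β ≤ H) (hμ0 : 0 ≤ μ) (hμ1 : μ ≤ 1)
    (hrq : r ≤ q) (hrμ : r ≤ μ * β - 2 * (H - β)) :
    ∃ C', 0 ≤ C' ∧ ∀ n : ℕ, (∀ k l, blockSum n ⌊μ * n⌋₊ (centredProduct T H n z k l)
      ≤ 2 * 2 ^ (-(n * q))) → ∀ k l, ∀ J ≤ 2 ^ n,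
      |∑ i ∈ Finset.range J, g k (dyadicPoint T n i) * g l (dyadicPoint T n i)
        * centredProduct T H n z k l i| ≤ C' * 2 ^ (-(n * r)) := by
  have hC := h.nonneg
  -- `X0` times `s ^ (1 - 2 * (H - β))` bounds one centred product: `C²` comes from the two
  -- increments, the other term from the compensator, as `s ^ (2 * H) ≤ T ^ (2 * (H - β)) * s ^ (2 *
  -- β)`.
  set X0 := C ^ 2 + T ^ (2 * (H - β)) with hX0
  have hX0' : 0 ≤ X0 := by positivity
  refine ⟨C ^ 2 * 2 + 2 * C ^ 2 * (2 * T) ^ β * (X0 * (T * T ^ (-(2 * (H - β)))))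
    + 2 * (C ^ 2 * (X0 * (T * T ^ (-(2 * (H - β)))))), by positivity, fun n hb k l J hJ => ?_⟩
  set s := T / 2 ^ n with hs
  have hs0 : 0 < s := by positivity
  have hs2 : 2 ^ n * s = T := by rw [hs]; field_simp
  obtain ⟨hmn, hm2⟩ := two_pow_floor_sub hμ0 hμ1 n
  set m := ⌊μ * n⌋₊ with hm
  set X := X0 * s ^ (1 - 2 * (H - β)) with hXdef
  set D := 2 * C ^ 2 * (2 ^ (n - m) * s) ^ β with hDdef
  have h2nX : 2 ^ n * X = X0 * (T * T ^ (-(2 * (H - β)))) * 2 ^ (-(n * -(2 * (H - β)))) := by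
    have : s ^ (1 - 2 * (H - β)) = s * (T ^ (-(2 * (H - β))) * 2 ^ (-(n * -(2 * (H - β))))) := by
      rw [sub_eq_add_neg, Real.rpow_add hs0, Real.rpow_one, hs, step_rpow hT]
    rw [hXdef, this]
    calc _ = X0 * ((2 ^ n * s) * (T ^ (-(2 * (H - β))) * 2 ^ (-(n * -(2 * (H - β)))))) := by ring
      _ = _ := by rw [hs2]; ring
  have key := abs_sum_mul_le_blockSum hmn (G := fun i => g k (dyadicPoint T n i)
    * g l (dyadicPoint T n i)) (ξ := centredProduct T H n z k l) (M := C ^ 2) (D := D) (X := X)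
    (by positivity) (by positivity) (by positivity) ?_ ?_ ?_ hJ
  · refine key.trans ?_
    have t1 : C ^ 2 * blockSum n m (centredProduct T H n z k l)
        ≤ C ^ 2 * 2 * 2 ^ (-(n * r)) := by
      rw [mul_assoc]
      refine mul_le_mul_of_nonneg_left ((hb k l).trans ?_) (by positivity)
      exact mul_le_mul_of_nonneg_left (two_rpow_neg_mul_le hrq n) zero_le_two
    -- Oscillation over a block gives `2^{-nμβ}`. The loss `2^{2n(H - β)}` arises because the
    -- products are bounded with `β` in place of `H`.
    have t2 : 2 ^ n * (D * X) ≤ 2 * C ^ 2 * (2 * T) ^ β * (X0 * (T * T ^ (-(2 * (H - β)))))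
        * 2 ^ (-(n * r)) := by
      have hD : D ≤ 2 * C ^ 2 * ((2 * T) ^ β * 2 ^ (-(n * (μ * β)))) := by
        refine mul_le_mul_of_nonneg_left ?_ (by positivity)
        have : 2 ^ (n - m) * s ≤ (2 * T) * 2 ^ (-(n * μ)) := by
          refine (mul_le_mul_of_nonneg_right hm2 hs0.le).trans (le_of_eq ?_)
          calc _ = (2 ^ n * s) * (2 * 2 ^ (-(n * μ))) := by ring
            _ = _ := by rw [hs2]; ring
        refine (Real.rpow_le_rpow (by positivity) this hβ.le).trans (le_of_eq ?_)
        rw [Real.mul_rpow (by positivity) (by positivity), ← Real.rpow_mul (by norm_num)]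
        congr 2; ring
      calc 2 ^ n * (D * X) = D * (2 ^ n * X) := by ring
        _ ≤ 2 * C ^ 2 * ((2 * T) ^ β * 2 ^ (-(n * (μ * β)))) * (2 ^ n * X) :=
          mul_le_mul_of_nonneg_right hD (by positivity)
        _ = 2 * C ^ 2 * (2 * T) ^ β * (X0 * (T * T ^ (-(2 * (H - β)))))
            * 2 ^ (-(n * (μ * β - 2 * (H - β)))) := by
          have : (2 : ℝ) ^ (-(n * (μ * β - 2 * (H - β)))) = 2 ^ (-(n * (μ * β)))
              * 2 ^ (-(n * -(2 * (H - β)))) := by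
            rw [← Real.rpow_add (by norm_num)]; congr 1; ring
          rw [h2nX, this]; ring
        _ ≤ _ := mul_le_mul_of_nonneg_left (two_rpow_neg_mul_le hrμ n) (by positivity)
    have t3 : 2 ^ (n - m) * (C ^ 2 * X) ≤ 2 * (C ^ 2 * (X0 * (T * T ^ (-(2 * (H - β))))))
        * 2 ^ (-(n * r)) := by
      calc 2 ^ (n - m) * (C ^ 2 * X) ≤ 2 ^ n * (2 * 2 ^ (-(n * μ))) * (C ^ 2 * X) :=
          mul_le_mul_of_nonneg_right hm2 (by positivity)
        _ = 2 * 2 ^ (-(n * μ)) * C ^ 2 * (2 ^ n * X) := by ring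
        _ = 2 * (C ^ 2 * (X0 * (T * T ^ (-(2 * (H - β))))))
            * 2 ^ (-(n * (μ - 2 * (H - β)))) := by
          have : (2 : ℝ) ^ (-(n * (μ - 2 * (H - β)))) = 2 ^ (-(n * μ))
              * 2 ^ (-(n * -(2 * (H - β)))) := by
            rw [← Real.rpow_add (by norm_num)]; congr 1; ring
          rw [h2nX, this]; ring
        _ ≤ _ := mul_le_mul_of_nonneg_left (two_rpow_neg_mul_le (by nlinarith) n) (by positivity)
    rw [add_mul, add_mul]
    exact add_le_add (add_le_add t1 t2) t3
  · intro i hi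
    have hmem := dyadicPoint_mem hT.le hi.le
    rw [abs_mul, sq]
    exact mul_le_mul (h.bound k _ hmem) (h.bound l _ hmem) (abs_nonneg _) hC
  · intro b hb i hi
    have hN : (b + 1) * 2 ^ (n - m) ≤ 2 ^ n := by
      calc (b + 1) * 2 ^ (n - m) ≤ 2 ^ m * 2 ^ (n - m) := Nat.mul_le_mul_right _ hb
        _ = 2 ^ n := by rw [← pow_add]; congr 1; omega
    have hlt : b * 2 ^ (n - m) + i ≤ 2 ^ n := by rw [add_mul, one_mul] at hN; omega
    have hle := dyadicPoint_mono hT.le n (Nat.le_add_right (b * 2 ^ (n - m)) i)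
    refine (h.abs_mul_sub_mul_le k l (dyadicPoint_mem hT.le (by omega)).1 hle
      (dyadicPoint_mem hT.le hlt).2).trans ?_
    refine mul_le_mul_of_nonneg_left (Real.rpow_le_rpow (by linarith) ?_ hβ.le) (by positivity)
    have e : dyadicPoint T n (b * 2 ^ (n - m) + i) - dyadicPoint T n (b * 2 ^ (n - m))
        = i * s := by
      simp only [dyadicPoint, hs]; push_cast; ring
    rw [e]
    refine mul_le_mul_of_nonneg_right ?_ hs0.le
    exact_mod_cast hi.le
  · intro i hi
    have hinc : ∀ k, |dyadicIncrement T n (z k) i| ≤ C * s ^ β := by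
      intro k
      have := h.path k _ _ (dyadicPoint_mem hT.le hi.le).1
        (dyadicPoint_mono hT.le n (Nat.le_succ i)) (dyadicPoint_mem hT.le hi).2
      rwa [Nat.succ_eq_add_one, dyadicPoint_succ_sub] at this
    have h1 : |dyadicIncrement T n (z k) i * dyadicIncrement T n (z l) i|
        ≤ C ^ 2 * s ^ (2 * β) := by
      rw [abs_mul]
      refine (mul_le_mul (hinc k) (hinc l) (abs_nonneg _) (by positivity)).trans (le_of_eq ?_)
      rw [two_mul, Real.rpow_add hs0]; ring
    have h2 : |(if k = l then s ^ (2 * H) else 0)| ≤ T ^ (2 * (H - β)) * s ^ (2 * β) := by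
      have : s ^ (2 * H) ≤ T ^ (2 * (H - β)) * s ^ (2 * β) := by
        have e : 2 * H = 2 * (H - β) + 2 * β := by ring
        rw [e, Real.rpow_add hs0]
        refine mul_le_mul_of_nonneg_right (Real.rpow_le_rpow hs0.le ?_ (by linarith))
          (by positivity)
        rw [hs]
        exact div_le_self hT.le (one_le_pow₀ (by norm_num))
      split_ifs
      · rwa [abs_of_nonneg (by positivity)]
      · rw [abs_zero]; positivity
    rw [centredProduct, abs_mul, abs_of_nonneg (by positivity)]
    calc _ ≤ s ^ (1 - 2 * H) * (C ^ 2 * s ^ (2 * β) + T ^ (2 * (H - β)) * s ^ (2 * β)) :=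
          mul_le_mul_of_nonneg_left ((abs_sub _ _).trans (add_le_add h1 h2)) (by positivity)
      _ = X := by
          have e : 1 - 2 * (H - β) = 1 - 2 * H + 2 * β := by ring
          rw [hXdef, e, Real.rpow_add hs0, hX0]; ring

/-- Writing an increment as `a + R`, the difference of squares is `(2a + R)R`, of order `s ^ (β +
ρ)`; there are at most `T / s` terms, each weighted by `s ^ (1 - 2 * H)`. -/
theorem exists_abs_sum_remainder_le (h : IsControlledWith T β ρ C z g x) (hT : 0 < T)
    {H r : ℝ} (hβρ : β ≤ ρ) (hrρ : r ≤ β + ρ - 2 * H) :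
    ∃ C', 0 ≤ C' ∧ ∀ n : ℕ, ∀ J ≤ 2 ^ n, |∑ i ∈ Finset.range J,
      (T / 2 ^ n) ^ (1 - 2 * H) * (dyadicIncrement T n x i ^ 2
        - (∑ k, g k (dyadicPoint T n i) * dyadicIncrement T n (z k) i) ^ 2)|
      ≤ C' * 2 ^ (-(n * r)) := by
  have hC := h.nonneg
  set c := (2 * (K * C ^ 2) + C * T ^ (ρ - β)) * C with hc
  have hc0 : 0 ≤ c := by positivity
  refine ⟨c * T * T ^ (β + ρ - 2 * H), by positivity, fun n J hJ => ?_⟩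
  set s := T / 2 ^ n with hs
  have hs0 : 0 < s := by positivity
  have hs2 : 2 ^ n * s = T := by rw [hs]; field_simp
  have hterm : ∀ i ∈ Finset.range J, |s ^ (1 - 2 * H) * (dyadicIncrement T n x i ^ 2
        - (∑ k, g k (dyadicPoint T n i) * dyadicIncrement T n (z k) i) ^ 2)|
      ≤ s ^ (1 - 2 * H) * (c * (s ^ β * s ^ ρ)) := by
    intro i hi
    rw [Finset.mem_range] at hi
    have hi0 := dyadicPoint_mem hT.le (hi.le.trans hJ)
    have hi1 := dyadicPoint_mem hT.le (show i + 1 ≤ 2 ^ n by omega)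
    have hle : dyadicPoint T n i ≤ dyadicPoint T n (i + 1) :=
      dyadicPoint_mono hT.le n (Nat.le_succ i)
    set a := ∑ k, g k (dyadicPoint T n i) * dyadicIncrement T n (z k) i with ha
    have hR : |dyadicIncrement T n x i - a| ≤ C * s ^ ρ := by
      have := h.remainder _ _ hi0.1 hle hi1.2
      rwa [dyadicPoint_succ_sub] at this
    have hA : |a| ≤ K * C ^ 2 * s ^ β := by
      refine (Finset.abs_sum_le_sum_abs _ _).trans ?_
      calc _ ≤ ∑ _k : Fin K, C * (C * s ^ β) := by
            refine Finset.sum_le_sum fun k _ => ?_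
            rw [abs_mul]
            have := h.path k _ _ hi0.1 hle hi1.2
            rw [dyadicPoint_succ_sub] at this
            exact mul_le_mul (h.bound k _ hi0) this (abs_nonneg _) hC
        _ = _ := by simp; ring
    have hR' : |dyadicIncrement T n x i - a| ≤ C * T ^ (ρ - β) * s ^ β := by
      refine hR.trans ?_
      rw [mul_assoc]
      refine mul_le_mul_of_nonneg_left ?_ hC
      have e : ρ = (ρ - β) + β := by ring
      nth_rewrite 1 [e]
      rw [Real.rpow_add hs0]
      refine mul_le_mul_of_nonneg_right (Real.rpow_le_rpow hs0.le ?_ (by linarith))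
        (by positivity)
      rw [hs]
      exact div_le_self hT.le (one_le_pow₀ (by norm_num))
    rw [abs_mul, abs_of_nonneg (by positivity : 0 ≤ s ^ (1 - 2 * H))]
    refine mul_le_mul_of_nonneg_left ?_ (by positivity)
    have e : dyadicIncrement T n x i ^ 2 - a ^ 2
        = (2 * a + (dyadicIncrement T n x i - a)) * (dyadicIncrement T n x i - a) := by ring
    have hsum : |2 * a + (dyadicIncrement T n x i - a)|
        ≤ (2 * (K * C ^ 2) + C * T ^ (ρ - β)) * s ^ β := by
      refine (abs_add_le _ _).trans ?_
      rw [abs_mul, abs_two]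
      linarith
    rw [e, abs_mul]
    refine (mul_le_mul hsum hR (abs_nonneg _) (by positivity)).trans (le_of_eq ?_)
    rw [hc]; ring
  refine (Finset.abs_sum_le_sum_abs _ _).trans ((Finset.sum_le_sum hterm).trans ?_)
  rw [Finset.sum_const, Finset.card_range, nsmul_eq_mul]
  calc (J : ℝ) * (s ^ (1 - 2 * H) * (c * (s ^ β * s ^ ρ)))
      ≤ 2 ^ n * (s ^ (1 - 2 * H) * (c * (s ^ β * s ^ ρ))) := by
        refine mul_le_mul_of_nonneg_right ?_ (by positivity)
        exact_mod_cast hJ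
    _ = c * T * s ^ (β + ρ - 2 * H) := by
        have e : s ^ (1 - 2 * H) * (s ^ β * s ^ ρ) = s * s ^ (β + ρ - 2 * H) := by
          have : s * s ^ (β + ρ - 2 * H) = s ^ (1 + (β + ρ - 2 * H)) := by
            rw [Real.rpow_add hs0, Real.rpow_one]
          rw [this, ← Real.rpow_add hs0, ← Real.rpow_add hs0]
          congr 1; ring
        calc _ = c * (2 ^ n * (s ^ (1 - 2 * H) * (s ^ β * s ^ ρ))) := by ring
          _ = c * ((2 ^ n * s) * s ^ (β + ρ - 2 * H)) := by rw [e]; ring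
          _ = _ := by rw [hs2]; ring
    _ ≤ _ := by
        rw [mul_assoc (c * T)]
        exact mul_le_mul_of_nonneg_left (step_rpow_le hT n hrρ) (by positivity)

/-- The rate of convergence of the scaled quadratic variation of a path controlled by `z`. -/
theorem exists_abs_scaledQV_sub_le (h : IsControlledWith T β ρ C z g x) (hT : 0 < T)
    {H μ q r : ℝ} (hβ : 0 < β) (hβ1 : β ≤ 1) (hβH : β ≤ H) (hμ0 : 0 ≤ μ) (hμ1 : μ ≤ 1)
    (hβρ : β ≤ ρ) (hrq : r ≤ q) (hrμ : r ≤ μ * β - 2 * (H - β)) (hrρ : r ≤ β + ρ - 2 * H) :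
    ∃ C', 0 ≤ C' ∧ ∀ n : ℕ, (∀ k l, blockSum n ⌊μ * n⌋₊ (centredProduct T H n z k l)
      ≤ 2 * 2 ^ (-(n * q))) → ∀ t ∈ Icc 0 T,
      |scaledQV T (1 - 2 * H) n x t - ∑ k, ∫ r in (0 : ℝ)..t, g k r ^ 2|
        ≤ C' * 2 ^ (-(n * r)) := by
  have hC := h.nonneg
  obtain ⟨c1, hc1, H1⟩ := h.exists_abs_sum_centredProduct_le hT hβ hβ1 hβH hμ0 hμ1 hrq hrμ
  obtain ⟨c2, hc2, H2⟩ := h.exists_abs_sum_remainder_le hT hβρ hrρ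
  set c3 := T * (2 * C ^ 2 * T ^ β) + C ^ 2 * T with hc3
  have hc3' : 0 ≤ c3 := by positivity
  refine ⟨K * (K * c1) + K * c3 + c2, by positivity, fun n hb t ht => ?_⟩
  have hJ := dyadicIndex_le hT n ht.2
  have H3 : ∀ k, |∑ i ∈ Finset.range (dyadicIndex T n t), (T / 2 ^ n) * g k (dyadicPoint T n i) ^ 2
      - ∫ r in (0 : ℝ)..t, g k r ^ 2| ≤ c3 * 2 ^ (-(n * r)) := by
    intro k
    refine (abs_riemannSum_sub_integral_le hT (G := fun r => g k r ^ 2) ((h.cont k).pow 2) (M := C ^ 2) (L := 2 * C ^ 2)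
      (β := β) (fun t ht => ?_) (by positivity) hβ.le (fun s t hs hst ht => ?_) n ht).trans ?_
    · rw [abs_pow]
      exact pow_le_pow_left₀ (abs_nonneg _) (h.bound k t ht) 2
    · simp only [sq]
      simpa only [sq] using h.abs_mul_sub_mul_le k k hs hst ht
    · have e1 := step_rpow_le hT n (show r ≤ β by nlinarith)
      have e2 := step_rpow_le hT n (show r ≤ 1 by nlinarith)
      rw [Real.rpow_one, Real.rpow_one] at e2
      have := mul_le_mul_of_nonneg_left e1 (by positivity : 0 ≤ T * (2 * C ^ 2))
      have := mul_le_mul_of_nonneg_left e2 (by positivity : 0 ≤ C ^ 2)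
      rw [hc3]
      linarith
  have hs0 : 0 < T / 2 ^ n := by positivity
  have hone : (T / 2 ^ n) ^ (1 - 2 * H) * (T / 2 ^ n) ^ (2 * H) = T / 2 ^ n := by
    rw [← Real.rpow_add hs0, sub_add_cancel, Real.rpow_one]
  -- Fluctuation of the noise, plus Riemann sum error, plus effect of the remainder. The
  -- compensators add up to the Riemann sum because `s ^ (1 - 2 * H) * s ^ (2 * H) = s`.
  have hdec : scaledQV T (1 - 2 * H) n x t - ∑ k, ∫ r in (0 : ℝ)..t, g k r ^ 2
      = ∑ k, ∑ l, ∑ i ∈ Finset.range (dyadicIndex T n t),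
          g k (dyadicPoint T n i) * g l (dyadicPoint T n i) * centredProduct T H n z k l i
        + ∑ k, (∑ i ∈ Finset.range (dyadicIndex T n t),
          (T / 2 ^ n) * g k (dyadicPoint T n i) ^ 2 - ∫ r in (0 : ℝ)..t, g k r ^ 2)
        + ∑ i ∈ Finset.range (dyadicIndex T n t),
          (T / 2 ^ n) ^ (1 - 2 * H) * (dyadicIncrement T n x i ^ 2
            - (∑ k, g k (dyadicPoint T n i) * dyadicIncrement T n (z k) i) ^ 2) := by
    rw [scaledQV_eq hT _ _ _ ht, Finset.sum_sub_distrib, add_sub_assoc', sub_add_eq_add_sub]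
    congr 1
    rw [Finset.sum_comm (s := Finset.univ) (t := Finset.range _)
      (f := fun k i => (T / 2 ^ n) * g k (dyadicPoint T n i) ^ 2)]
    simp_rw [Finset.sum_comm (s := Finset.univ) (t := Finset.range (dyadicIndex T n t))]
    rw [← Finset.sum_add_distrib, ← Finset.sum_add_distrib]
    refine Finset.sum_congr rfl fun i _ => ?_
    have e : ∀ k, ∑ l, g k (dyadicPoint T n i) * g l (dyadicPoint T n i)
        * centredProduct T H n z k l i = (T / 2 ^ n) ^ (1 - 2 * H) *
          ((g k (dyadicPoint T n i) * dyadicIncrement T n (z k) i)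
          * ∑ l, g l (dyadicPoint T n i) * dyadicIncrement T n (z l) i)
          - (T / 2 ^ n) * g k (dyadicPoint T n i) ^ 2 := by
      intro k
      have : ∀ l, g k (dyadicPoint T n i) * g l (dyadicPoint T n i) * centredProduct T H n z k l i
          = (T / 2 ^ n) ^ (1 - 2 * H) * ((g k (dyadicPoint T n i) * dyadicIncrement T n (z k) i)
            * (g l (dyadicPoint T n i) * dyadicIncrement T n (z l) i))
          - (if k = l then (T / 2 ^ n) * g k (dyadicPoint T n i) ^ 2 else 0) := by
        intro l
        rw [centredProduct]
        split_ifs with hkl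
        · subst hkl
          linear_combination (-(g k (dyadicPoint T n i) ^ 2)) * hone
        · ring
      simp_rw [this, Finset.sum_sub_distrib, ← Finset.mul_sum]
      simp
    simp_rw [e, Finset.sum_sub_distrib, ← Finset.mul_sum, ← Finset.sum_mul]
    ring
  rw [hdec]
  refine (abs_add_le _ _).trans ?_
  rw [add_mul]
  refine add_le_add ((abs_add_le _ _).trans ?_) (H2 n _ hJ)
  rw [add_mul]
  refine add_le_add ?_ ?_
  · refine (Finset.abs_sum_le_sum_abs _ _).trans ?_
    calc _ ≤ ∑ _k : Fin K, ∑ _l : Fin K, c1 * 2 ^ (-(n * r)) := by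
          refine Finset.sum_le_sum fun k _ => (Finset.abs_sum_le_sum_abs _ _).trans ?_
          exact Finset.sum_le_sum fun l _ => H1 n hb k l _ hJ
      _ = _ := by simp; ring
  · refine (Finset.abs_sum_le_sum_abs _ _).trans ((Finset.sum_le_sum fun k _ => H3 k).trans ?_)
    simp; ring_nf; rfl

end IsControlledWith

/-! ### Pathwise regularity of solutions -/

theorem IsTwoParamHolder.exists_norm_le {E : Type*} [NormedAddCommGroup E] {T α : ℝ}
    {A : ℝ → ℝ → E} (hA : IsTwoParamHolder T α A) :
    ∃ C, 0 ≤ C ∧ ∀ s t, 0 ≤ s → s ≤ t → t ≤ T → ‖A s t‖ ≤ C * (t - s) ^ α := by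
  have hA' : holderSeminorm₂ T α A < ∞ := hA
  refine ⟨(holderSeminorm₂ T α A).toReal, ENNReal.toReal_nonneg, fun s t hs hst ht => ?_⟩
  have h1 : ‖A s t‖ₑ / ENNReal.ofReal ((t - s) ^ α) ≤ holderSeminorm₂ T α A :=
    le_iSup₂_of_le s ⟨hs, hst.trans ht⟩ (le_iSup₂_of_le t ⟨hst, ht⟩ le_rfl)
  have h2 : ‖A s t‖ₑ ≤ holderSeminorm₂ T α A * ENNReal.ofReal ((t - s) ^ α) := by
    refine (ENNReal.div_le_iff_le_mul ?_ (Or.inl ENNReal.ofReal_ne_top)).1 h1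
    exact Or.inr hA'.ne
  have h3 := ENNReal.toReal_mono (ENNReal.mul_ne_top hA'.ne ENNReal.ofReal_ne_top) h2
  rwa [ENNReal.toReal_mul, ENNReal.toReal_ofReal (Real.rpow_nonneg (by linarith) _),
    toReal_enorm] at h3

theorem rpow_le_mul_rpow {T τ e ρ : ℝ} (hτ : 0 ≤ τ) (hτT : τ ≤ T) (hρ : 0 < ρ) (he : ρ ≤ e) :
    τ ^ e ≤ T ^ (e - ρ) * τ ^ ρ := by
  have : e = (e - ρ) + ρ := by ring
  conv_lhs => rw [this]
  rw [Real.rpow_add_of_nonneg hτ (by linarith) hρ.le]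
  exact mul_le_mul_of_nonneg_right (Real.rpow_le_rpow hτ hτT (by linarith)) (by positivity)

theorem exists_norm_sub_le_of_contDiff {d : ℕ} {F : Type*} [NormedAddCommGroup F]
    [NormedSpace ℝ F] {φ : EuclideanSpace ℝ (Fin d) → F} (hφ : ContDiff ℝ 1 φ) (R : ℝ) :
    ∃ L, 0 ≤ L ∧ ∀ x ∈ Metric.closedBall 0 R, ∀ y ∈ Metric.closedBall 0 R,
      ‖φ x - φ y‖ ≤ L * ‖x - y‖ := by
  obtain ⟨L, hL⟩ := (hφ.locallyLipschitz.locallyLipschitzOn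
    (s := Metric.closedBall 0 R)).exists_lipschitzOnWith_of_compact (isCompact_closedBall _ _)
  exact ⟨L, L.2, fun x hx y hy => hL.norm_sub_le hx hy⟩

/-- The derivative is Lipschitz on the ball, and the mean value inequality is applied on the
segment. A ball suffices, since a continuous path stays in one on `[0, T]`. -/
theorem exists_norm_taylor_le {d : ℕ} {f : EuclideanSpace ℝ (Fin d) → ℝ} (hf : ContDiff ℝ 2 f)
    (R : ℝ) : ∃ L, 0 ≤ L ∧ ∀ x ∈ Metric.closedBall 0 R, ∀ y ∈ Metric.closedBall 0 R,
      |f y - f x - fderiv ℝ f x (y - x)| ≤ L * ‖y - x‖ ^ 2 := by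
  obtain ⟨L, hL0, hL⟩ := exists_norm_sub_le_of_contDiff
    (hf.fderiv_right (m := 1) (by norm_num)) R
  refine ⟨L, hL0, fun x hx y hy => ?_⟩
  have hseg : segment ℝ x y ⊆ Metric.closedBall 0 R := (convex_closedBall _ _).segment_subset hx hy
  have := (convex_segment x y).norm_image_sub_le_of_norm_hasFDerivWithin_le'
    (f := f) (f' := fderiv ℝ f) (φ := fderiv ℝ f x) (C := L * ‖y - x‖)
    (fun w _ => ((hf.differentiable (by norm_num)) w).hasFDerivAt.hasFDerivWithinAt)
    (fun w hw => (hL w (hseg hw) x hx).trans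
      (mul_le_mul_of_nonneg_left ?_ hL0)) (left_mem_segment ℝ x y) (right_mem_segment ℝ x y)
  · rw [Real.norm_eq_abs] at this
    rwa [sq, ← mul_assoc]
  · have h1 := norm_sub_le_of_mem_segment hw
    rwa [norm_sub_rev y x, norm_sub_rev w x] at *

theorem contDiff_lieAction {d : ℕ} {F : Type*} [NormedAddCommGroup F] [NormedSpace ℝ F]
    {σ : EuclideanSpace ℝ (Fin d) → EuclideanSpace ℝ (Fin d)}
    {f : EuclideanSpace ℝ (Fin d) → F} {m n : WithTop ℕ∞} (hσ : ContDiff ℝ m σ)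
    (hf : ContDiff ℝ n f) (hmn : m + 1 ≤ n) : ContDiff ℝ m (lieAction σ f) :=
  (hf.fderiv_right hmn).clm_apply hσ

section Pathwise

variable {d K : ℕ} {T : ℝ}
  {u : ℝ → EuclideanSpace ℝ (Fin d) → EuclideanSpace ℝ (Fin d)}
  {σ : Fin K → EuclideanSpace ℝ (Fin d) → EuclideanSpace ℝ (Fin d)}
  {z : ℝ → EuclideanSpace ℝ (Fin K)} {y : ℝ → EuclideanSpace ℝ (Fin d)}

theorem IsHolderPath.continuousOn {E : Type*} [NormedAddCommGroup E] {α : ℝ} {x : ℝ → E}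
    (hα : 0 < α) (hx : IsHolderPath T α x) : ContinuousOn x (Icc 0 T) := by
  obtain ⟨C, hC0, hC⟩ := IsTwoParamHolder.exists_norm_le (show IsTwoParamHolder T α _ from hx)
  have hC' : ∀ s ∈ Icc 0 T, ∀ t ∈ Icc 0 T, ‖x t - x s‖ ≤ C * |t - s| ^ α := by
    intro s hs t ht
    rcases le_total s t with h | h
    · rw [abs_of_nonneg (by linarith)]
      exact hC s t hs.1 h ht.2
    · rw [abs_of_nonpos (by linarith), norm_sub_rev, neg_sub]
      exact hC t s ht.1 h hs.2
  intro s hs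
  rw [ContinuousWithinAt, tendsto_iff_norm_sub_tendsto_zero]
  refine squeeze_zero' (Eventually.of_forall fun t => norm_nonneg _)
    (eventually_mem_nhdsWithin.mono fun t ht => hC' s hs t ht) ?_
  have : ContinuousAt (fun t => C * |t - s| ^ α) s :=
    continuousAt_const.mul (((continuous_id.sub continuous_const).abs.continuousAt).rpow_const
      (Or.inr hα.le))
  have h := this.tendsto
  simp only [sub_self, abs_zero, Real.zero_rpow hα.ne', mul_zero] at h
  exact h.mono_left nhdsWithin_le_nhds

theorem exists_bound_continuousOn {E : Type*} [NormedAddCommGroup E] {x : ℝ → E}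
    (hx : ContinuousOn x (Icc 0 T)) : ∃ C, 0 ≤ C ∧ ∀ t ∈ Icc 0 T, ‖x t‖ ≤ C := by
  obtain ⟨C, hC⟩ := isCompact_Icc.exists_bound_of_continuousOn hx
  exact ⟨max C 0, le_max_right _ _, fun t ht => (hC t ht).trans (le_max_left _ _)⟩

theorem exists_norm_drift_le (hy : ContinuousOn y (Icc 0 T))
    (hu : ContinuousOn (Function.uncurry u) (Icc 0 T ×ˢ univ)) :
    ∃ C, 0 ≤ C ∧ ∀ s t, 0 ≤ s → s ≤ t → t ≤ T → ‖∫ r in s..t, u r (y r)‖ ≤ C * (t - s) := by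
  have : ContinuousOn (fun r => u r (y r)) (Icc 0 T) :=
    hu.comp (continuousOn_id.prodMk hy) fun r hr => ⟨hr, mem_univ _⟩
  obtain ⟨C, hC0, hC⟩ := exists_bound_continuousOn this
  refine ⟨C, hC0, fun s t hs hst ht => ?_⟩
  have := intervalIntegral.norm_integral_le_of_norm_le_const (C := C) (a := s) (b := t)
    (f := fun r => u r (y r)) fun r hr => by
      rw [uIoc_of_le hst] at hr
      exact hC r ⟨hs.trans hr.1.le, hr.2.trans ht⟩
  rwa [abs_of_nonneg (by linarith)] at this

/-- In the Young regime the remainder of a solution is `O(|t - s|^ρ)`. -/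
theorem IsRDESolution.exists_norm_sharp_le_of_young {α ρ : ℝ} {Z : ℝ → ℝ → Fin K → Fin K → ℝ}
    (h : IsRDESolution T α u σ z Z y) (hρ : 0 < ρ) (hρα : ρ ≤ 2 * α) (hT : 0 < T) :
    ∃ C, 0 ≤ C ∧ ∀ s t, 0 ≤ s → s ≤ t → t ≤ T →
      ‖rdeSharp u σ z y s t‖ ≤ C * (t - s) ^ ρ := by
  obtain ⟨C, hC0, hC⟩ := h.sharp.exists_norm_le
  refine ⟨C * T ^ (2 * α - ρ), by positivity, fun s t hs hst ht => ?_⟩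
  refine (hC s t hs hst ht).trans ?_
  rw [mul_assoc]
  exact mul_le_mul_of_nonneg_left (rpow_le_mul_rpow (by linarith) (by linarith) hρ hρα) hC0

/-- In the rough regime the second order expansion of a solution improves the bound on its
remainder. -/
theorem IsRDESolution.exists_norm_sharp_le_of_rough {α β ρ : ℝ}
    {Z : ℝ → ℝ → Fin K → Fin K → ℝ}
    (h : IsRDESolution T α u σ z Z y) (hα0 : 0 < α) (hα : α ≤ 1 / 2) (hρ : 0 < ρ)
    (hρα : ρ ≤ 3 * α) (hρβ : ρ ≤ 2 * β) (hZ : IsTwoParamHolder T (2 * β) Z) (hT : 0 < T)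
    (hσ : ∀ k, ContDiff ℝ 1 (σ k)) :
    ∃ C, 0 ≤ C ∧ ∀ s t, 0 ≤ s → s ≤ t → t ≤ T →
      ‖rdeSharp u σ z y s t‖ ≤ C * (t - s) ^ ρ := by
  -- The second-order remainder has order `3α ≥ ρ`, so the first-order one inherits the regularity
  -- `2β` of the area. This frees the estimates from the given `α`, which may be far below `H`.
  obtain ⟨C, hC0, hC⟩ := (h.natural hα).exists_norm_le
  obtain ⟨D, hD0, hD⟩ := hZ.exists_norm_le
  have hy := IsHolderPath.continuousOn hα0 h.holder
  have hL : ∀ k l, ∃ M, 0 ≤ M ∧ ∀ t ∈ Icc 0 T, ‖lieAction (σ l) (σ k) (y t)‖ ≤ M := by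
    intro k l
    refine exists_bound_continuousOn ?_
    exact (contDiff_lieAction (m := 0) ((hσ l).of_le (by norm_num)) (hσ k)
      (by norm_num)).continuous.comp_continuousOn hy
  choose M hM0 hM using hL
  refine ⟨C * T ^ (3 * α - ρ) + ∑ k, ∑ l, D * T ^ (2 * β - ρ) * M k l, ?_,
    fun s t hs hst ht => ?_⟩
  · have : 0 ≤ ∑ k, ∑ l, D * T ^ (2 * β - ρ) * M k l :=
      Finset.sum_nonneg fun k _ => Finset.sum_nonneg fun l _ =>
        mul_nonneg (by positivity) (hM0 k l)
    positivity
  have h1 : ‖rdeNatural u σ z Z y s t‖ ≤ C * T ^ (3 * α - ρ) * (t - s) ^ ρ := by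
    refine (hC s t hs hst ht).trans ?_
    rw [mul_assoc]
    exact mul_le_mul_of_nonneg_left (rpow_le_mul_rpow (by linarith) (by linarith) hρ hρα) hC0
  have h2 : ‖∑ k, ∑ l, Z s t l k • lieAction (σ l) (σ k) (y s)‖
      ≤ (∑ k, ∑ l, D * T ^ (2 * β - ρ) * M k l) * (t - s) ^ ρ := by
    rw [Finset.sum_mul]
    refine norm_sum_le_of_le _ fun k _ => ?_
    rw [Finset.sum_mul]
    refine norm_sum_le_of_le _ fun l _ => ?_
    rw [norm_smul]
    have hz : ‖Z s t l k‖ ≤ D * T ^ (2 * β - ρ) * (t - s) ^ ρ := by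
      refine ((norm_le_pi_norm (Z s t l) k).trans (norm_le_pi_norm (Z s t) l)).trans ?_
      refine (hD s t hs hst ht).trans ?_
      rw [mul_assoc]
      exact mul_le_mul_of_nonneg_left (rpow_le_mul_rpow (by linarith) (by linarith) hρ hρβ) hD0
    have hp : 0 ≤ (t - s) ^ ρ := Real.rpow_nonneg (by linarith) _
    refine (mul_le_mul hz (hM k l s ⟨hs, hst.trans ht⟩) (norm_nonneg _) (by positivity)).trans
      (le_of_eq (by ring))
  have e : rdeSharp u σ z y s t = rdeNatural u σ z Z y s t
      + ∑ k, ∑ l, Z s t l k • lieAction (σ l) (σ k) (y s) := by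
    rw [rdeNatural, sub_add_cancel]
  rw [e, add_mul]
  exact (norm_add_le _ _).trans (add_le_add h1 h2)

/-- Smooth functions of a solution are controlled by the driving path. -/
theorem exists_isControlledWith {β ρ : ℝ} (hT : 0 < T) (hβ : 0 < β) (hβρ : β ≤ ρ) (hρ1 : ρ ≤ 1)
    (hρβ : ρ ≤ 2 * β) (hσ : ∀ k, ContDiff ℝ 1 (σ k)) (hy : ContinuousOn y (Icc 0 T))
    (hu : ContinuousOn (Function.uncurry u) (Icc 0 T ×ˢ univ))
    (hz : ∀ k, ∃ C, 0 ≤ C ∧ ∀ s t, 0 ≤ s → s ≤ t → t ≤ T → |z t k - z s k| ≤ C * (t - s) ^ β)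
    (hs : ∃ C, 0 ≤ C ∧ ∀ s t, 0 ≤ s → s ≤ t → t ≤ T →
      ‖rdeSharp u σ z y s t‖ ≤ C * (t - s) ^ ρ)
    {f : EuclideanSpace ℝ (Fin d) → ℝ} (hf : ContDiff ℝ 2 f) :
    ∃ C, IsControlledWith T β ρ C (fun k t => z t k) (fun k t => lieAction (σ k) f (y t))
      (fun t => f (y t)) := by
  have hρ0 : 0 < ρ := hβ.trans_le hβρ
  obtain ⟨R, hR0, hR⟩ := exists_bound_continuousOn hy
  have hmem : ∀ t ∈ Icc 0 T, y t ∈ Metric.closedBall 0 R := fun t ht => by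
    rw [mem_closedBall_zero_iff]; exact hR t ht
  choose Cz hCz0 hCz using hz
  obtain ⟨Cs, hCs0, hCs⟩ := hs
  obtain ⟨Cu, hCu0, hCu⟩ := exists_norm_drift_le hy hu
  have hσb : ∀ k, ∃ M, 0 ≤ M ∧ ∀ t ∈ Icc 0 T, ‖σ k (y t)‖ ≤ M := fun k =>
    exists_bound_continuousOn ((hσ k).continuous.comp_continuousOn hy)
  choose Mσ hMσ0 hMσ using hσb
  have hgd : ∀ k, ContDiff ℝ 1 (lieAction (σ k) f) := fun k =>
    contDiff_lieAction (hσ k) hf (by norm_num)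
  have hgc : ∀ k, ContinuousOn (fun t => lieAction (σ k) f (y t)) (Icc 0 T) := fun k =>
    (hgd k).continuous.comp_continuousOn hy
  choose Mg hMg0 hMg using fun k => exists_bound_continuousOn (hgc k)
  choose Lg hLg0 hLg using fun k => exists_norm_sub_le_of_contDiff (hgd k) R
  obtain ⟨Mf, hMf0, hMf⟩ := exists_bound_continuousOn
    ((hf.continuous_fderiv (by norm_num)).comp_continuousOn hy)
  obtain ⟨Lf, hLf0, hLf⟩ := exists_norm_taylor_le hf R
  -- the first order part
  set A := Cs + Cu * T ^ (1 - ρ) with hA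
  have hA0 : 0 ≤ A := by positivity
  have hfirst : ∀ s t, 0 ≤ s → s ≤ t → t ≤ T →
      ‖y t - y s - ∑ k, (z t k - z s k) • σ k (y s)‖ ≤ A * (t - s) ^ ρ := by
    intro s t h0 hst ht
    have e : y t - y s - ∑ k, (z t k - z s k) • σ k (y s)
        = rdeSharp u σ z y s t + ∫ r in s..t, u r (y r) := by rw [rdeSharp]; abel
    rw [e, hA, add_mul]
    refine (norm_add_le _ _).trans (add_le_add (hCs s t h0 hst ht) ?_)
    refine (hCu s t h0 hst ht).trans ?_
    rw [mul_assoc]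
    refine mul_le_mul_of_nonneg_left ?_ hCu0
    have := rpow_le_mul_rpow (T := T) (τ := t - s) (by linarith) (by linarith) hρ0 hρ1
    rwa [Real.rpow_one] at this
  -- Reading the expansion backwards makes `y` Hölder with the exponent `β` of the driving path.
  set Y := A * T ^ (ρ - β) + ∑ k, Cz k * Mσ k with hY
  have hY0 : 0 ≤ Y := by
    have : 0 ≤ ∑ k, Cz k * Mσ k := Finset.sum_nonneg fun k _ => mul_nonneg (hCz0 k) (hMσ0 k)
    positivity
  have hyh : ∀ s t, 0 ≤ s → s ≤ t → t ≤ T → ‖y t - y s‖ ≤ Y * (t - s) ^ β := by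
    intro s t h0 hst ht
    have e : y t - y s = (y t - y s - ∑ k, (z t k - z s k) • σ k (y s))
        + ∑ k, (z t k - z s k) • σ k (y s) := by abel
    rw [e, hY, add_mul]
    refine (norm_add_le _ _).trans (add_le_add ?_ ?_)
    · refine (hfirst s t h0 hst ht).trans ?_
      rw [mul_assoc]
      exact mul_le_mul_of_nonneg_left (rpow_le_mul_rpow (by linarith) (by linarith) hβ hβρ) hA0
    · rw [Finset.sum_mul]
      refine norm_sum_le_of_le _ fun k _ => ?_
      rw [norm_smul, Real.norm_eq_abs]
      have hp : 0 ≤ (t - s) ^ β := Real.rpow_nonneg (by linarith) _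
      refine (mul_le_mul (hCz k s t h0 hst ht) (hMσ k s ⟨h0, hst.trans ht⟩) (norm_nonneg _)
        (mul_nonneg (hCz0 k) hp)).trans (le_of_eq (by ring))
  set D := Lf * Y ^ 2 * T ^ (2 * β - ρ) + Mf * A with hD
  have hD0 : 0 ≤ D := by positivity
  have hrem : ∀ s t, 0 ≤ s → s ≤ t → t ≤ T →
      |f (y t) - f (y s) - ∑ k, lieAction (σ k) f (y s) * (z t k - z s k)|
        ≤ D * (t - s) ^ ρ := by
    intro s t h0 hst ht
    -- The Taylor error is of order `2β ≥ ρ`; the linear part sees only the first-order remainder of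
    -- `y`. The drift, being of order `1`, is what requires `ρ ≤ 1`.
    have e : f (y t) - f (y s) - ∑ k, lieAction (σ k) f (y s) * (z t k - z s k)
        = (f (y t) - f (y s) - fderiv ℝ f (y s) (y t - y s))
          + fderiv ℝ f (y s) (y t - y s - ∑ k, (z t k - z s k) • σ k (y s)) := by
      rw [map_sub _ (y t - y s), map_sum]
      simp only [map_smul, smul_eq_mul, lieAction]
      simp_rw [mul_comm (fderiv ℝ f (y s) (σ _ (y s)))]
      ring
    rw [e, hD, add_mul]
    refine (abs_add_le _ _).trans (add_le_add ?_ ?_)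
    · refine (hLf _ (hmem s ⟨h0, hst.trans ht⟩) _ (hmem t ⟨h0.trans hst, ht⟩)).trans ?_
      rw [mul_assoc, mul_assoc]
      refine mul_le_mul_of_nonneg_left ?_ hLf0
      refine (pow_le_pow_left₀ (norm_nonneg _) (hyh s t h0 hst ht) 2).trans ?_
      rw [mul_pow, ← Real.rpow_mul_natCast (by linarith)]
      refine mul_le_mul_of_nonneg_left ?_ (by positivity)
      have := rpow_le_mul_rpow (T := T) (τ := t - s) (by linarith) (by linarith) hρ0 hρβ
      rwa [mul_comm 2 β] at this ⊢
    · refine ((fderiv ℝ f (y s)).le_opNorm _).trans ?_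
      rw [mul_assoc]
      exact mul_le_mul (hMf s ⟨h0, hst.trans ht⟩) (hfirst s t h0 hst ht) (norm_nonneg _) hMf0
  have hS1 : ∀ {a : Fin K → ℝ} (_ : ∀ k, 0 ≤ a k) k, a k ≤ ∑ k, a k := fun h k =>
    Finset.single_le_sum (fun k _ => h k) (Finset.mem_univ k)
  have hs1 : 0 ≤ ∑ k, Cz k := Finset.sum_nonneg fun k _ => hCz0 k
  have hs2 : 0 ≤ ∑ k, Mg k := Finset.sum_nonneg fun k _ => hMg0 k
  have hs3 : 0 ≤ ∑ k, Lg k * Y := Finset.sum_nonneg fun k _ => mul_nonneg (hLg0 k) hY0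
  refine ⟨∑ k, Cz k + ∑ k, Mg k + ∑ k, Lg k * Y + D, by positivity, ?_, ?_, ?_, hgc, ?_⟩
  · intro k s t h0 hst ht
    refine (hCz k s t h0 hst ht).trans (mul_le_mul_of_nonneg_right ?_
      (Real.rpow_nonneg (by linarith) _))
    linarith [hS1 hCz0 k]
  · intro k s t h0 hst ht
    have hp : 0 ≤ (t - s) ^ β := Real.rpow_nonneg (by linarith) _
    refine (hLg k _ (hmem t ⟨h0.trans hst, ht⟩) _ (hmem s ⟨h0, hst.trans ht⟩)).trans ?_
    refine (mul_le_mul_of_nonneg_left (hyh s t h0 hst ht) (hLg0 k)).trans ?_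
    rw [← mul_assoc]
    refine mul_le_mul_of_nonneg_right ?_ hp
    linarith [hS1 (fun k => mul_nonneg (hLg0 k) hY0) k]
  · intro k t ht
    refine (hMg k t ht).trans ?_
    linarith [hS1 hMg0 k]
  · intro s t h0 hst ht
    refine (hrem s t h0 hst ht).trans (mul_le_mul_of_nonneg_right ?_
      (Real.rpow_nonneg (by linarith) _))
    linarith

end Pathwise

/-! ### Consistency of the estimator -/

/-- An admissible Hölder exponent for every rate `r < H min(1/2, 1 - H)`. -/
theorem exists_holder_exponent {H μ r : ℝ} (hH0 : 1 / 3 < H) (hH1 : H < 1)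
    (hμ : μ = min (1 / 2) (1 - H)) (hr : r < H * μ) :
    r < (1 - μ) * μ ∧ ∃ β, 1 / 3 < β ∧ β < H ∧ r ≤ μ * β - 2 * (H - β) ∧
      r ≤ β + min (2 * β) 1 - 2 * H := by
  have hμ1 : μ ≤ 1 / 2 := by rw [hμ]; exact min_le_left _ _
  have hμ2 : μ ≤ 1 - H := by rw [hμ]; exact min_le_right _ _
  have hμ0 : 0 < μ := by rw [hμ]; exact lt_min (by norm_num) (by linarith)
  refine ⟨hr.trans_le (mul_le_mul_of_nonneg_right (by linarith) hμ0.le), ?_⟩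
  -- With `β = H - η` the worst loss is `3η`, since `μ + 2 ≤ 3`; the second entry keeps `β > 1/3`.
  set η := min ((H * μ - r) / 3) ((H - 1 / 3) / 2) with hη
  have h1 : η ≤ (H * μ - r) / 3 := min_le_left _ _
  have h2 : η ≤ (H - 1 / 3) / 2 := min_le_right _ _
  have h0 : 0 < η := lt_min (by linarith) (by linarith)
  refine ⟨H - η, by linarith, by linarith, by nlinarith, ?_⟩
  rw [← min_add_add_left, ← min_sub_sub_right]
  refine le_min ?_ ?_ <;> nlinarith

/-- Almost surely, every `C²` function of the solution has scaled quadratic variations that converge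
at each rate below `H min(1/2, 1 - H)`. -/
theorem ae_exists_abs_scaledQV_sub_le {d K : ℕ} {H : ℝ} (hH0 : 1 / 3 < H) (hH1 : H < 1)
    {T : ℝ} (hT : 0 < T) {Ω : Type*} [MeasurableSpace Ω] {P : Measure Ω}
    {B : ℝ → Ω → EuclideanSpace ℝ (Fin K)} (hB : IsFractionalBrownianMotion H B P)
    {BB : Ω → ℝ → ℝ → Fin K → Fin K → ℝ}
    (hBB : H ≤ 1 / 2 → ∀ᵐ ω ∂P, ∀ β : ℝ, 1 / 3 < β → β < H →
      IsHolderRoughPath T β (fun t => B t ω) (BB ω))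
    {α : ℝ} (hα0 : 1 / 3 < α) (hα1 : α < H) (hα2 : 1 / 2 < H → 1 / 2 < α)
    {u : ℝ → EuclideanSpace ℝ (Fin d) → EuclideanSpace ℝ (Fin d)}
    (hu : ContinuousOn (Function.uncurry u) (Icc 0 T ×ˢ univ))
    {σ : Fin K → EuclideanSpace ℝ (Fin d) → EuclideanSpace ℝ (Fin d)}
    (hσ : ∀ k, ContDiff ℝ 1 (σ k))
    {y : ℝ → Ω → EuclideanSpace ℝ (Fin d)}
    (hy : ∀ᵐ ω ∂P, IsRDESolution T α u σ (fun t => B t ω) (BB ω) (fun t => y t ω))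
    {r : ℝ} (hr : r < H * min (1 / 2) (1 - H)) :
    ∀ᵐ ω ∂P, ContinuousOn (fun t => y t ω) (Icc 0 T) ∧
      ∀ f : EuclideanSpace ℝ (Fin d) → ℝ, ContDiff ℝ 2 f →
      ∃ C, 0 ≤ C ∧ ∀ᶠ n : ℕ in atTop, ∀ t ∈ Icc 0 T,
        |scaledQV T (1 - 2 * H) n (fun s => f (y s ω)) t
          - ∑ k, ∫ s in (0 : ℝ)..t, lieAction (σ k) f (y s ω) ^ 2| ≤ C * 2 ^ (-(n * r)) ∧
        |∑ k, ∫ s in (0 : ℝ)..t, lieAction (σ k) f (y s ω) ^ 2| ≤ C := by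
  have hH : 0 < H := by linarith
  set μ := min (1 / 2) (1 - H) with hμ
  have hμ1 : μ ≤ 1 / 2 := min_le_left _ _
  have hμ0 : 0 < μ := lt_min (by norm_num) (by linarith)
  obtain ⟨hq, β, hβ0, hβH, hr1, hr2⟩ := exists_holder_exponent hH0 hH1 hμ hr
  have hβ : 0 < β := by linarith
  set ρ := min (2 * β) 1 with hρ
  have hρ0 : 0 < ρ := lt_min (by linarith) one_pos
  have hBB' : ∀ᵐ ω ∂P, H ≤ 1 / 2 → IsHolderRoughPath T β (fun t => B t ω) (BB ω) := by
    by_cases h : H ≤ 1 / 2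
    · filter_upwards [hBB h] with ω hω _ using hω β hβ0 hβH
    · exact Eventually.of_forall fun ω h' => absurd h' h
  filter_upwards [hB.ae_blockSum_le hH hH1 hT hμ hq, hB.ae_dyadicIncrement_le hH hT hβH,
    hB.continuous_paths, hBB', hy] with ω h1 h2 h3 h4 h5
  have hyc := IsHolderPath.continuousOn (by linarith) h5.holder
  refine ⟨hyc, fun f hf => ?_⟩
  have hz : ∀ k, ∃ C, 0 ≤ C ∧ ∀ s t, 0 ≤ s → s ≤ t → t ≤ T →
      |B t ω k - B s ω k| ≤ C * (t - s) ^ β := by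
    intro k
    refine exists_holder_of_dyadicIncrement (x := fun t => B t ω k) hT ?_ hβ
      (h2.mono fun n hn => hn k)
    exact (EuclideanSpace.proj k : EuclideanSpace ℝ (Fin K) →L[ℝ] ℝ).continuous.comp_continuousOn
      (h3.mono Icc_subset_Ici_self)
  have hs : ∃ C, 0 ≤ C ∧ ∀ s t, 0 ≤ s → s ≤ t → t ≤ T →
      ‖rdeSharp u σ (fun t => B t ω) (fun t => y t ω) s t‖ ≤ C * (t - s) ^ ρ := by
    -- Here `ρ ≤ 1`, while `3α > 1` in the rough regime and `2α > 1` in the Young regime.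
    rcases le_or_gt H (1 / 2) with h | h
    · exact h5.exists_norm_sharp_le_of_rough (β := β) (by linarith) (by linarith) hρ0
        ((min_le_right _ _).trans (by linarith)) (min_le_left _ _) (h4 h).holder_area hT hσ
    · exact h5.exists_norm_sharp_le_of_young hρ0
        ((min_le_right _ _).trans (by linarith [hα2 h])) hT
  obtain ⟨C, hC⟩ := exists_isControlledWith hT hβ (le_min (by linarith) (by linarith))
    (min_le_right _ _) (min_le_left _ _) hσ hyc hu hz hs hf
  obtain ⟨C', hC'0, hC'⟩ := hC.exists_abs_scaledQV_sub_le hT hβ (by linarith) hβH.le hμ0.le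
    (by linarith) (le_min (by linarith) (by linarith)) le_rfl hr1 hr2
  have hC0 := hC.nonneg
  -- One constant serves both as the rate constant and as a bound for the limit.
  refine ⟨C' + K * (C ^ 2 * T), by positivity, ?_⟩
  filter_upwards [h1] with n hn t ht
  constructor
  · refine (hC' n hn t ht).trans (mul_le_mul_of_nonneg_right ?_ (by positivity))
    have : 0 ≤ (K : ℝ) * (C ^ 2 * T) := by positivity
    linarith
  · refine (Finset.abs_sum_le_sum_abs _ _).trans ?_
    have hk : ∀ k, |∫ s in (0 : ℝ)..t, lieAction (σ k) f (y s ω) ^ 2| ≤ C ^ 2 * T := by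
      intro k
      refine (intervalIntegral.norm_integral_le_of_norm_le_const (C := C ^ 2)
        (f := fun s => lieAction (σ k) f (y s ω) ^ 2) (a := 0) (b := t) fun s hs => ?_).trans ?_
      · rw [uIoc_of_le ht.1] at hs
        rw [norm_pow]
        exact pow_le_pow_left₀ (norm_nonneg _) (hC.bound k s ⟨hs.1.le, hs.2.trans ht.2⟩) 2
      · rw [sub_zero, abs_of_nonneg ht.1]
        exact mul_le_mul_of_nonneg_left ht.2 (by positivity)
    refine (Finset.sum_le_sum fun k _ => hk k).trans ?_
    simp [hC'0]

/-! ### Stability of the estimator and of the scaling exponent -/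

theorem scaledQV_change_exponent {T : ℝ} (hT : 0 < T) (γ γ' : ℝ) (n : ℕ) (x : ℝ → ℝ) (t : ℝ) :
    scaledQV T γ' n x t = (T / 2 ^ n) ^ (γ' - γ) * scaledQV T γ n x t := by
  rw [scaledQV, scaledQV, Finset.mul_sum]
  refine Finset.sum_congr rfl fun i _ => ?_
  have hs : 0 < T / 2 ^ n := by positivity
  rw [dyadicPoint_succ_sub, ← mul_assoc, ← Real.rpow_add hs, sub_add_cancel]

theorem abs_log_sub_log_le {a b L : ℝ} (hL : 0 < L) (ha : L ≤ a) (hb : L ≤ b) :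
    |Real.log a - Real.log b| ≤ |a - b| / L := by
  wlog hab : b ≤ a generalizing a b
  · rw [abs_sub_comm, abs_sub_comm a b]
    exact this hb ha (le_of_not_ge hab)
  have hb0 : 0 < b := hL.trans_le hb
  have ha0 : 0 < a := hL.trans_le ha
  rw [abs_of_nonneg (sub_nonneg.2 (Real.log_le_log hb0 hab)), abs_of_nonneg (by linarith),
    ← Real.log_div ha0.ne' hb0.ne']
  refine (Real.log_le_sub_one_of_pos (by positivity)).trans ?_
  have : a / b - 1 = (a - b) / b := by field_simp
  rw [this]
  gcongr

/-- The Hurst estimator in terms of the correctly scaled quadratic variations. -/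
theorem hurstEstimator_sub {d : ℕ} {T : ℝ} (hT : 0 < T) (H : ℝ)
    (y : ℝ → EuclideanSpace ℝ (Fin d)) (n : ℕ) (h0 : 0 < totalScaledQV T (1 - 2 * H) n y T)
    (h1 : 0 < totalScaledQV T (1 - 2 * H) (n + 1) y T) :
    hurstEstimator T y n - H = -(Real.log (totalScaledQV T (1 - 2 * H) (n + 1) y T)
      - Real.log (totalScaledQV T (1 - 2 * H) n y T)) / (2 * Real.log 2) := by
  -- Passing from level `n` to `n + 1` changes the logarithm of the prefactor by `(1 - 2H) log 2`,
  -- which is how the estimator reads off `H`.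
  have e : ∀ m, totalScaledQV T 0 m y T
      = (T / 2 ^ m) ^ (2 * H - 1) * totalScaledQV T (1 - 2 * H) m y T := by
    intro m
    rw [totalScaledQV, totalScaledQV, Finset.mul_sum]
    refine Finset.sum_congr rfl fun i _ => ?_
    rw [scaledQV_change_exponent hT (1 - 2 * H) 0]
    congr 2; ring
  have hl2 : 0 < Real.log 2 := Real.log_pos (by norm_num)
  have hlog : ∀ m : ℕ, Real.log (T / 2 ^ m) = Real.log T - m * Real.log 2 := by
    intro m
    rw [Real.log_div hT.ne' (by positivity), Real.log_pow]
  have hs : ∀ m : ℕ, 0 < T / 2 ^ m := fun m => by positivity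
  rw [hurstEstimator, e, e, Real.log_div (mul_pos (Real.rpow_pos_of_pos (hs _) _) h1).ne'
    (mul_pos (Real.rpow_pos_of_pos (hs _) _) h0).ne',
    Real.log_mul (Real.rpow_pos_of_pos (hs _) _).ne' h1.ne',
    Real.log_mul (Real.rpow_pos_of_pos (hs _) _).ne' h0.ne', Real.log_rpow (hs _),
    Real.log_rpow (hs _), hlog, hlog]
  push_cast
  field_simp
  ring

/-- If the total scaled quadratic variation converges at rate `2^{-nr}` to a positive limit, then
so does the Hurst estimator. -/
theorem exists_abs_hurstEstimator_sub_le {d : ℕ} {T : ℝ} (hT : 0 < T) (H : ℝ)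
    {y : ℝ → EuclideanSpace ℝ (Fin d)} {L C r : ℝ} (hL : 0 < L) (hC : 0 ≤ C) (hr : 0 < r)
    (h : ∀ᶠ n : ℕ in atTop, |totalScaledQV T (1 - 2 * H) n y T - L| ≤ C * 2 ^ (-(n * r))) :
    ∃ C', 0 ≤ C' ∧ ∀ᶠ n : ℕ in atTop, |hurstEstimator T y n - H| ≤ C' * 2 ^ (-(n * r)) := by
  have hl2 : 0 < Real.log 2 := Real.log_pos (by norm_num)
  refine ⟨2 * C / (L / 2) / (2 * Real.log 2), by positivity, ?_⟩
  have hlim : Tendsto (fun n : ℕ => C * (2 : ℝ) ^ (-(n * r))) atTop (nhds 0) := by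
    have : Tendsto (fun n : ℕ => C * ((2 : ℝ) ^ (-r)) ^ n) atTop (nhds (C * 0)) :=
      (tendsto_pow_atTop_nhds_zero_of_lt_one (by positivity)
        (Real.rpow_lt_one_of_one_lt_of_neg (by norm_num) (by linarith))).const_mul C
    rw [mul_zero] at this
    refine this.congr fun n => ?_
    rw [← Real.rpow_mul_natCast (by norm_num)]
    congr 2; ring
  -- Eventually both levels lie above `L / 2`, where the logarithm is Lipschitz with constant `2 /
  -- L`.
  have hsmall := hlim.eventually_le_const (half_pos hL)
  filter_upwards [h, (tendsto_add_atTop_nat 1).eventually h, hsmall,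
    (tendsto_add_atTop_nat 1).eventually hsmall] with n h1 h2 h3 h4
  have g1 := abs_le.1 (h1.trans h3)
  have g2 := abs_le.1 (h2.trans h4)
  have a1 : L / 2 ≤ totalScaledQV T (1 - 2 * H) n y T := by linarith
  have a2 : L / 2 ≤ totalScaledQV T (1 - 2 * H) (n + 1) y T := by linarith
  have hmono : (2 : ℝ) ^ (-(((n + 1 : ℕ) : ℝ) * r)) ≤ 2 ^ (-(n * r)) := by
    refine Real.rpow_le_rpow_of_exponent_le (by norm_num) ?_
    push_cast
    nlinarith
  have hdiff : |totalScaledQV T (1 - 2 * H) (n + 1) y T - totalScaledQV T (1 - 2 * H) n y T|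
      ≤ 2 * C * 2 ^ (-(n * r)) := by
    have := mul_le_mul_of_nonneg_left hmono hC
    have b1 := abs_le.1 h1
    have b2 := abs_le.1 h2
    rw [abs_le]; constructor <;> linarith
  rw [hurstEstimator_sub hT H y n (by linarith) (by linarith), abs_div, abs_neg,
    abs_of_pos (by positivity : 0 < 2 * Real.log 2)]
  calc _ ≤ 2 * C * 2 ^ (-(n * r)) / (L / 2) / (2 * Real.log 2) := by
        gcongr
        exact (abs_log_sub_log_le (by positivity) a2 a1).trans (by gcongr)
    _ = _ := by ring

theorem tendsto_nat_mul_two_rpow {r : ℝ} (hr : 0 < r) (C : ℝ) :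
    Tendsto (fun n : ℕ => C * (n * (2 : ℝ) ^ (-(n * r)))) atTop (nhds 0) := by
  have : Tendsto (fun n : ℕ => C * (n * ((2 : ℝ) ^ (-r)) ^ n)) atTop (nhds (C * 0)) :=
    (tendsto_self_mul_const_pow_of_lt_one (by positivity)
      (Real.rpow_lt_one_of_one_lt_of_neg (by norm_num) (by linarith))).const_mul C
  rw [mul_zero] at this
  refine this.congr fun n => ?_
  rw [← Real.rpow_mul_natCast (by norm_num)]
  congr 3; ring

/-- Replacing the Hurst index by an estimator in the scaling costs a factor `n`. -/
theorem exists_abs_scaledQV_estimated_sub_le {T : ℝ} (hT : 0 < T) {H r C D : ℝ} (hr : 0 < r)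
    (hC : 0 ≤ C) (hD : 0 ≤ D) {x V : ℝ → ℝ} {Hn : ℕ → ℝ}
    (hHn : ∀ᶠ n : ℕ in atTop, |Hn n - H| ≤ D * 2 ^ (-(n * r)))
    (h : ∀ᶠ n : ℕ in atTop, ∀ t ∈ Icc 0 T,
      |scaledQV T (1 - 2 * H) n x t - V t| ≤ C * 2 ^ (-(n * r)) ∧ |V t| ≤ C) :
    ∃ C', 0 ≤ C' ∧ ∀ᶠ n : ℕ in atTop, ∀ t ∈ Icc 0 T,
      |scaledQV T (1 - 2 * Hn n) n x t - V t| ≤ C' * (n * 2 ^ (-(n * r))) := by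
  set E := 2 * D * (|Real.log T| + 1) with hE
  have hE0 : 0 ≤ E := by positivity
  refine ⟨2 * E * (2 * C) + C, by positivity, ?_⟩
  filter_upwards [hHn, h, eventually_ge_atTop 1,
    (tendsto_nat_mul_two_rpow hr E).eventually_le_const one_pos] with n h1 h2 hn h3 t ht
  obtain ⟨h4, h5⟩ := h2 t ht
  have hn1 : (1 : ℝ) ≤ n := by exact_mod_cast hn
  have hs : 0 < T / 2 ^ n := by positivity
  have hp : (0 : ℝ) < 2 ^ (-(n * r)) := by positivity
  have hp1 : (2 : ℝ) ^ (-(n * r)) ≤ 1 :=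
    Real.rpow_le_one_of_one_le_of_nonpos (by norm_num) (by nlinarith)
  rw [scaledQV_change_exponent hT (1 - 2 * H)]
  set Q := scaledQV T (1 - 2 * H) n x t
  -- The factor `n` is born here: `|log h|` is at most `(|log T| + 1) n`, and it multiplies the
  -- error in the exponent.
  have hw : |Real.log (T / 2 ^ n) * (1 - 2 * Hn n - (1 - 2 * H))| ≤ E * (n * 2 ^ (-(n * r))) := by
    have hlog : |Real.log (T / 2 ^ n)| ≤ (|Real.log T| + 1) * n := by
      rw [Real.log_div hT.ne' (by positivity), Real.log_pow]
      refine (abs_sub _ _).trans ?_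
      rw [abs_mul, abs_of_nonneg (by positivity : (0 : ℝ) ≤ n),
        abs_of_pos (Real.log_pos (by norm_num : (1 : ℝ) < 2))]
      have := Real.log_two_lt_d9
      nlinarith [abs_nonneg (Real.log T)]
    have e : 1 - 2 * Hn n - (1 - 2 * H) = -(2 * (Hn n - H)) := by ring
    rw [abs_mul, e, abs_neg, abs_mul, abs_two]
    calc _ ≤ (|Real.log T| + 1) * n * (2 * (D * 2 ^ (-(n * r)))) := by gcongr
      _ = _ := by rw [hE]; ring
  -- The exponent is eventually at most `1` in absolute value, where `|exp w - 1| ≤ 2 |w|`.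
  have hF : |(T / 2 ^ n) ^ (1 - 2 * Hn n - (1 - 2 * H)) - 1| ≤ 2 * (E * (n * 2 ^ (-(n * r)))) := by
    rw [Real.rpow_def_of_pos hs]
    exact (Real.abs_exp_sub_one_le (hw.trans h3)).trans (by gcongr)
  have hQ : |Q| ≤ 2 * C := by
    have b1 := abs_le.1 h4
    have b2 := abs_le.1 h5
    have := mul_le_mul_of_nonneg_left hp1 hC
    rw [abs_le]; constructor <;> linarith
  set F := (T / 2 ^ n) ^ (1 - 2 * Hn n - (1 - 2 * H))
  have e : F * Q - V t = (F - 1) * Q + (Q - V t) := by ring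
  rw [e]
  refine (abs_add_le _ _).trans ?_
  rw [abs_mul, add_mul]
  refine add_le_add ?_ (h4.trans ?_)
  · calc _ ≤ 2 * (E * (n * 2 ^ (-(n * r)))) * (2 * C) := by gcongr
      _ = _ := by ring
  · refine mul_le_mul_of_nonneg_left ?_ hC
    exact le_mul_of_one_le_left hp.le hn1

theorem dyadicRate_eq (H : ℝ) (n : ℕ) :
    dyadicRate H n = 2 ^ (-(n * min (1 / 2) (1 - H))) * √(n : ℝ) := by
  rw [dyadicRate]
  split_ifs with h
  · rw [min_eq_left (by linarith)]; congr 2; ring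
  · rw [min_eq_right (by linarith)]; congr 2; ring

/-- For `e ≥ 0` the factor `√n ≥ 1` only helps. For `e ≤ 0`, which occurs when `ε ≥ H`, the rate is
eventually at most `1`, so its power is at least `1`. -/
theorem eventually_le_dyadicRate_rpow {H : ℝ} (hH1 : H < 1) (e : ℝ) :
    ∀ᶠ n : ℕ in atTop,
      (2 : ℝ) ^ (-(n * (max e 0 * min (1 / 2) (1 - H)))) ≤ dyadicRate H n ^ e := by
  set μ := min (1 / 2) (1 - H) with hμ
  have hμ0 : 0 < μ := lt_min (by norm_num) (by linarith)
  filter_upwards [eventually_ge_atTop 1,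
    (tendsto_nat_mul_two_rpow hμ0 1).eventually_le_const one_pos] with n hn h1
  have hn1 : (1 : ℝ) ≤ n := by exact_mod_cast hn
  have hsq : 1 ≤ √(n : ℝ) := Real.one_le_sqrt.2 hn1
  have hp : (0 : ℝ) < 2 ^ (-(n * μ)) := by positivity
  rw [dyadicRate_eq, ← hμ]
  rcases le_total 0 e with he | he
  · rw [max_eq_left he]
    have : (2 : ℝ) ^ (-(n * (e * μ))) = (2 ^ (-(n * μ))) ^ e := by
      rw [← Real.rpow_mul (by norm_num)]; congr 1; ring
    rw [this]
    exact Real.rpow_le_rpow hp.le (le_mul_of_one_le_right hp.le hsq) he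
  · rw [max_eq_right he, zero_mul, mul_zero, neg_zero, Real.rpow_zero]
    refine Real.one_le_rpow_of_pos_of_le_one_of_nonpos (by positivity) ?_ he
    have : √(n : ℝ) ≤ n := by
      rw [Real.sqrt_le_left (by positivity)]; nlinarith
    rw [one_mul] at h1
    calc _ ≤ 2 ^ (-(n * μ)) * (n : ℝ) := by gcongr
      _ ≤ 1 := by linarith

/-- Identifies the limit of the total variation of `y` with the quantity assumed positive. -/
theorem sum_integral_lieAction_proj {d K : ℕ} {T : ℝ} (hT : 0 ≤ T)
    {σ : Fin K → EuclideanSpace ℝ (Fin d) → EuclideanSpace ℝ (Fin d)}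
    (hσ : ∀ k, Continuous (σ k)) {y : ℝ → EuclideanSpace ℝ (Fin d)}
    (hy : ContinuousOn y (Icc 0 T)) :
    ∑ i, ∑ k, ∫ s in (0 : ℝ)..T, lieAction (σ k)
      (fun x : EuclideanSpace ℝ (Fin d) => x i) (y s) ^ 2
      = ∑ k, ∫ s in (0 : ℝ)..T, ‖σ k (y s)‖ ^ 2 := by
  rw [Finset.sum_comm]
  refine Finset.sum_congr rfl fun k _ => ?_
  have e : ∀ (i : Fin d) s, lieAction (σ k) (fun x : EuclideanSpace ℝ (Fin d) => x i) (y s)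
      = σ k (y s) i := by
    intro i s
    have : (fun x : EuclideanSpace ℝ (Fin d) => x i)
        = (EuclideanSpace.proj i : EuclideanSpace ℝ (Fin d) →L[ℝ] ℝ) := rfl
    rw [lieAction, this, ContinuousLinearMap.fderiv]
    rfl
  simp_rw [e, EuclideanSpace.real_norm_sq_eq]
  rw [intervalIntegral.integral_finsetSum]
  intro i _
  refine ContinuousOn.intervalIntegrable ?_
  rw [uIcc_of_le hT]
  exact (((EuclideanSpace.proj i : EuclideanSpace ℝ (Fin d) →L[ℝ] ℝ).continuous.comp
    (hσ k)).comp_continuousOn hy).pow 2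

theorem mainTheorem10 (d K : ℕ) (H ε : ℝ) (hH₀ : 1 / 3 < H) (hH₁ : H < 1) (hε : 0 < ε) :
    ∃ C : ℝ → ℝ≥0∞ → ℝ≥0∞ → ℝ≥0∞ → ℝ,
      ∀ (T : ℝ), 0 < T →
      ∀ (Ω : Type*) [MeasurableSpace Ω] (P : Measure Ω) [IsProbabilityMeasure P]
        (B : ℝ → Ω → EuclideanSpace ℝ (Fin K)), IsFractionalBrownianMotion H B P →
      ∀ (BB : Ω → ℝ → ℝ → Fin K → Fin K → ℝ),
        -- for `H ≤ 1/2`, `(B, BB)` is a rough path lift of `B`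
        (H ≤ 1 / 2 → ∀ᵐ ω ∂P, ∀ β : ℝ, 1 / 3 < β → β < H →
          IsHolderRoughPath T β (fun t => B t ω) (BB ω)) →
      ∀ (α : ℝ), 1 / 3 < α → α < H → (1 / 2 < H → 1 / 2 < α) →
      ∀ (u : ℝ → EuclideanSpace ℝ (Fin d) → EuclideanSpace ℝ (Fin d)),
        ContinuousOn (Function.uncurry u) (Icc 0 T ×ˢ univ) →
      ∀ (σ : Fin K → EuclideanSpace ℝ (Fin d) → EuclideanSpace ℝ (Fin d)),
        (∀ k, ContDiff ℝ (⌊1 / α⌋₊ : ℕ∞) (σ k)) →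
      ∀ (y : ℝ → Ω → EuclideanSpace ℝ (Fin d)),
        (∀ᵐ ω ∂P, IsRDESolution T α u σ (fun t => B t ω) (BB ω) (fun t => y t ω)) →
      ∀ (f : EuclideanSpace ℝ (Fin d) → ℝ), ContDiff ℝ 2 f →
      ∀ᵐ ω ∂P, 0 < ∑ k, ∫ r in (0 : ℝ)..T, ‖σ k (y r ω)‖ ^ 2 →
        ∀ᶠ n : ℕ in atTop, ∀ t ∈ Icc (0 : ℝ) T,
          |scaledQV T (1 - 2 * hurstEstimator T (fun r => y r ω) n) n (fun r => f (y r ω)) t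
              - ∑ k, ∫ r in (0 : ℝ)..t, |lieAction (σ k) f (y r ω)| ^ 2|
            ≤ C T (holderNorm T (H - ε) (fun r => B r ω))
                (holderNorm T (H - ε) (gubinelliDeriv σ f (fun r => y r ω)))
                (holderSeminorm₂ T (2 * (H - ε))
                  (gubinelliRemainder σ f (fun r => B r ω) (fun r => y r ω)))
              * (n * dyadicRate H n ^ (H - ε)) := by
  -- The loss `ε` in the exponent absorbs every pathwise constant, so that `C = 1` will do.
  refine ⟨fun _ _ _ _ => 1, ?_⟩
  intro T hT Ω _ P _ B hB BB hBB α hα0 hα1 hα2 u hu σ hσ y hy f hf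
  set μ := min (1 / 2) (1 - H) with hμ
  have hμ0 : 0 < μ := lt_min (by norm_num) (by linarith)
  set p := max (H - ε) 0 with hp
  have hpH : p < H := max_lt (by linarith) (by linarith)
  have hp0 : 0 ≤ p := le_max_right _ _
  -- Strictly between `p * μ`, the exponent to be reached, and `H * μ`, the supremum of the
  -- available rates.
  set r := (p + H) / 2 * μ with hr
  have hr0 : 0 < r := mul_pos (by linarith) hμ0
  have hrH : r < H * μ := mul_lt_mul_of_pos_right (by linarith) hμ0
  have hpr : 0 < r - p * μ := by
    rw [hr, ← sub_mul]; exact mul_pos (by linarith) hμ0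
  have hσ1 : ∀ k, ContDiff ℝ 1 (σ k) := by
    intro k
    refine (hσ k).of_le ?_
    have : 1 ≤ ⌊1 / α⌋₊ := by
      rw [Nat.one_le_floor_iff, le_div_iff₀ (by linarith)]; linarith
    exact_mod_cast this
  filter_upwards [ae_exists_abs_scaledQV_sub_le hH₀ hH₁ hT hB hBB hα0 hα1 hα2 hu hσ1 hy hrH]
    with ω ⟨hyc, hω⟩ hpos
  obtain ⟨C, hC0, hC⟩ := hω f hf
  -- The convergence result is used twice on the same event: for `f`, and for the coordinates that
  -- enter the estimator.
  have hcoord : ∀ i : Fin d, ContDiff ℝ 2 (fun x : EuclideanSpace ℝ (Fin d) => x i) := fun i =>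
    (EuclideanSpace.proj i : EuclideanSpace ℝ (Fin d) →L[ℝ] ℝ).contDiff
  choose c hc0 hc using fun i => hω _ (hcoord i)
  have htotal : ∀ᶠ n : ℕ in atTop, |totalScaledQV T (1 - 2 * H) n (fun r => y r ω) T
      - ∑ k, ∫ r in (0 : ℝ)..T, ‖σ k (y r ω)‖ ^ 2| ≤ (∑ i, c i) * 2 ^ (-(n * r)) := by
    filter_upwards [eventually_all.2 hc] with n hn
    rw [← sum_integral_lieAction_proj hT.le (fun k => (hσ1 k).continuous) hyc, totalScaledQV,
      ← Finset.sum_sub_distrib, Finset.sum_mul]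
    exact (Finset.abs_sum_le_sum_abs _ _).trans
      (Finset.sum_le_sum fun i _ => (hn i T ⟨hT.le, le_rfl⟩).1)
  obtain ⟨D, hD0, hD⟩ := exists_abs_hurstEstimator_sub_le hT H hpos
    (Finset.sum_nonneg fun i _ => hc0 i) hr0 htotal
  obtain ⟨C', hC'0, hC'⟩ := exists_abs_scaledQV_estimated_sub_le hT hr0 hC0 hD0 hD hC
  have hlim := (tendsto_nat_mul_two_rpow hpr C').eventually_le_const one_pos
  filter_upwards [hC', eventually_le_dyadicRate_rpow hH₁ (H - ε), hlim, eventually_ge_atTop 1]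
    with n h1 h2 h3 hn t ht
  simp only [sq_abs, one_mul]
  refine (h1 t ht).trans ?_
  have hn1 : (1 : ℝ) ≤ n := by exact_mod_cast hn
  have hq : (0 : ℝ) < 2 ^ (-(n * (r - p * μ))) := by positivity
  have hsplit : (2 : ℝ) ^ (-(n * r)) = 2 ^ (-(n * (r - p * μ))) * 2 ^ (-(n * (p * μ))) := by
    rw [← Real.rpow_add (by norm_num)]; congr 1; ring
  -- The surplus `r - p * μ > 0` swallows the random constant from some random `n` on.
  have h4 : C' * 2 ^ (-(n * (r - p * μ))) ≤ 1 := by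
    refine le_trans (mul_le_mul_of_nonneg_left ?_ hC'0) h3
    exact le_mul_of_one_le_left hq.le hn1
  calc C' * (n * 2 ^ (-(n * r)))
      = n * ((C' * 2 ^ (-(n * (r - p * μ)))) * 2 ^ (-(n * (p * μ)))) := by rw [hsplit]; ring
    _ ≤ n * (1 * 2 ^ (-(n * (p * μ)))) := by gcongr
    _ ≤ _ := by rw [one_mul]; gcongr
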